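/- All graphs are simple and undirected. A ray (double ray) is a one-way (two-way) infinite sequence of distinct, consecutively adjacent vertices; a double ray is also regarded as the subgraph formed by its vertices and edges. For a set $K$ of vertices of a graph $X$, $X\setminus K$ is obtained by deleting $K$ and all incident edges. Two rays are equivalent if for every finite $K$ all but finitely many of the vertices of both lie in the same component of $X\setminus K$; an end is an equivalence class of rays, and $C_X(K,\omega)$ is the component of $X\setminus K$ containing all but finitely many vertices of every ray in the end $\omega$. A defining sequence of $\omega$ is a sequence $(K_n)_{n\ge 0}$ of finite non-empty sets of vertices with $K_n\cup C_X(K_n,\omega)\subseteq C_X(K_{n-1},\omega)$ for all $n\ge 1$. The end $\omega$ is thin of size $m$ if $m$ is the least number such that $\omega$ has a defining sequence with $|K_n|=m$ for all $n$. A group of automorphisms of $X$ acts quasi-transitively if it has only finitely many orbits on the vertices; $X$ is quasi-transitive if its full automorphism group $\mathrm{Aut}(X)$ acts quasi-transitively. Let $\tau$ be an automorphism of a graph $S$. We call $S$ a $\tau$-strip of size $m$ if $S$ is connected, locally finite and quasi-transitive, has precisely two ends $\omega^+$ and $\omega^-$, both of size $m$, and there is a finite set $K$ of $m$ vertices of $S$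 such that * $(\tau^nK)_{n\ge 0}$ and $(\tau^{-n}K)_{n\ge 0}$ are defining sequences of $\omega^+$ and $\omega^-$, respectively; * there are $m$ pairwise disjoint $\tau$-invariant double rays in $S$, each of which meets every $\tau^nK$ $(n\in\mathbb Z)$ in precisely one vertex; * the subgraph of $S$ induced by $\bigl(K\cup C_S(K,\omega^+)\bigr)\setminus C_S(\tau K,\omega^+)$ is finite and connected. If $S$ is a subgraph of a graph $X$ and $\tau\in\mathrm{Aut}(X)$, then $S$ is called a $\tau$-strip of size $m$ if $\tau$ restricts to an automorphism of $S$ for which the above holds. **Lemma.** Let $X$ be a locally finite connected graph and let $\Gamma\le\mathrm{Aut}(X)$ act quasi-transitively on $X$. If $X$ has a thin end of size $m$, then there is some $\tau\in\Gamma$ such that $X$ contains a $\tau$-strip of size $m$ as a subgraph. -/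

import Mathlib

namespace GraphStrip

universe u

variable {V : Type u} {G : SimpleGraph V}

/-- A ray: a one-way infinite sequence of distinct, consecutively adjacent vertices. -/
structure Ray (G : SimpleGraph V) where
  /-- the `n`-th vertex -/
  vertex : ℕ → V
  injective : Function.Injective vertex
  adj : ∀ n, G.Adj (vertex n) (vertex (n + 1))

/-- A double ray: a two-way infinite sequence of distinct, consecutively adjacent vertices. -/
structure DoubleRay (G : SimpleGraph V) where
  /-- the `n`-th vertex -/
  vertex : ℤ → V
  injective : Function.Injective vertex
  adj : ∀ n, G.Adj (vertex n) (vertex (n + 1))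

/-- The subgraph formed by the vertices and the edges of a double ray. -/
def DoubleRay.toSubgraph (d : DoubleRay G) : G.Subgraph where
  verts := Set.range d.vertex
  Adj a b := ∃ n : ℤ,
    (a = d.vertex n ∧ b = d.vertex (n + 1)) ∨ (b = d.vertex n ∧ a = d.vertex (n + 1))
  adj_sub := by
    rintro a b ⟨n, ⟨rfl, rfl⟩ | ⟨rfl, rfl⟩⟩
    · exact d.adj n
    · exact (d.adj n).symm
  edge_vert := by
    rintro a b ⟨n, ⟨rfl, rfl⟩ | ⟨rfl, rfl⟩⟩
    · exact ⟨n, rfl⟩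
    · exact ⟨n + 1, rfl⟩
  symm := ⟨by
    rintro a b ⟨n, h⟩
    exact ⟨n, h.symm⟩⟩

/-- All but finitely many vertices of the ray lie in the component `C` of `G \ K`. -/
def Ray.EndsUpIn (r : Ray G) {K : Set V} (C : G.ComponentCompl K) : Prop :=
  ∃ N, ∀ n, N ≤ n → r.vertex n ∈ C

theorem Ray.exists_endsUpIn (r : Ray G) {K : Set V} (hK : K.Finite) :
    ∃ C : G.ComponentCompl K, r.EndsUpIn C := by
  have hfin : (r.vertex ⁻¹' K).Finite := hK.preimage r.injective.injOn
  obtain ⟨M, hM⟩ := hfin.bddAbove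
  have hout : ∀ n, M + 1 ≤ n → r.vertex n ∉ K := fun n hn hmem => by
    have : n ≤ M := hM hmem
    omega
  refine ⟨G.componentComplMk (hout (M + 1) le_rfl), M + 1, fun n hn => ?_⟩
  induction n, hn using Nat.le_induction with
  | base => exact G.componentComplMk_mem _
  | succ n hn ih =>
    exact SimpleGraph.ComponentCompl.mem_of_adj _ _ ih (hout _ (by omega)) (r.adj n)

theorem Ray.EndsUpIn.unique {r : Ray G} {K : Set V} {C D : G.ComponentCompl K}
    (hC : r.EndsUpIn C) (hD : r.EndsUpIn D) : C = D := by
  obtain ⟨N, hN⟩ := hC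
  obtain ⟨M, hM⟩ := hD
  obtain ⟨_, h₁⟩ := hN (max N M) (le_max_left _ _)
  obtain ⟨_, h₂⟩ := hM (max N M) (le_max_right _ _)
  exact h₁.symm.trans h₂

/-- Two rays are equivalent if, for every finite `K`, they end up in the same component of
`G \ K`. -/
def Ray.Equivalent (r s : Ray G) : Prop :=
  ∀ K : Set V, K.Finite → ∃ C : G.ComponentCompl K, r.EndsUpIn C ∧ s.EndsUpIn C

/-- Equivalence of rays as a setoid. -/
def raySetoid (G : SimpleGraph V) : Setoid (Ray G) where
  r := Ray.Equivalent
  iseqv :=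
    { refl := fun r K hK => by
        obtain ⟨C, hC⟩ := r.exists_endsUpIn hK
        exact ⟨C, hC, hC⟩
      symm := fun h K hK => by
        obtain ⟨C, h₁, h₂⟩ := h K hK
        exact ⟨C, h₂, h₁⟩
      trans := fun h h' K hK => by
        obtain ⟨C, h₁, h₂⟩ := h K hK
        obtain ⟨D, h₃, h₄⟩ := h' K hK
        obtain rfl := h₂.unique h₃
        exact ⟨C, h₁, h₄⟩ }

/-- An end: an equivalence class of rays. -/
def GraphEnd (G : SimpleGraph V) : Type u := Quotient (raySetoid G)

/-- The end represented by a ray. -/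
def Ray.toEnd (r : Ray G) : GraphEnd G := Quotient.mk (raySetoid G) r

/-- The vertex set of `C(K, ω)`, the component of `G \ K` in which all rays representing `ω`
end up. For finite `K` there is exactly one such component. -/
def GraphEnd.comp (ω : GraphEnd G) (K : Set V) : Set V :=
  {v | ∃ C : G.ComponentCompl K, v ∈ C ∧ ∀ r : Ray G, r.toEnd = ω → r.EndsUpIn C}

/-- For finite `K`, the set `r.toEnd.comp K` is the component in which `r` ends up. -/
theorem Ray.EndsUpIn.comp_toEnd {r : Ray G} {K : Set V} (hK : K.Finite) {C : G.ComponentCompl K}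
    (hC : r.EndsUpIn C) : r.toEnd.comp K = (C : Set V) := by
  ext v
  constructor
  · rintro ⟨D, hv, hD⟩
    obtain rfl := (hD r rfl).unique hC
    exact hv
  · intro hv
    refine ⟨C, hv, fun s hs => ?_⟩
    obtain ⟨D, h₁, h₂⟩ := (Quotient.exact hs : Ray.Equivalent s r) K hK
    obtain rfl := h₂.unique hC
    exact h₁

/-- A defining sequence of the end `ω`: finite nonempty vertex sets `K 0, K 1, …` such that
`C(K n, ω)` contains `K (n + 1)` and `C(K (n + 1), ω)`. -/
def IsDefiningSequence (ω : GraphEnd G) (K : ℕ → Set V) : Prop :=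
  (∀ n, (K n).Finite ∧ (K n).Nonempty) ∧
    ∀ n, K (n + 1) ∪ ω.comp (K (n + 1)) ⊆ ω.comp (K n)

/-- The end `ω` is thin of size `m`: `m` is the least number such that `ω` has a defining
sequence all of whose members have exactly `m` elements. -/
def GraphEnd.IsThinOfSize (ω : GraphEnd G) (m : ℕ) : Prop :=
  IsLeast {k : ℕ | ∃ K : ℕ → Set V, IsDefiningSequence ω K ∧ ∀ n, (K n).ncard = k} m

/-- Every vertex has finitely many neighbours. -/
def IsLocallyFinite (G : SimpleGraph V) : Prop := ∀ v, (G.neighborSet v).Finite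

/-- The group `Γ` of automorphisms of `G` has only finitely many orbits of vertices. -/
def ActsQuasiTransitively (Γ : Subgroup (G ≃g G)) : Prop :=
  (Set.range fun x : V => {y : V | ∃ γ ∈ Γ, γ x = y}).Finite

/-- `S` is a `τ`-strip of size `m`. -/
def IsStripOfSize {W : Type u} (S : SimpleGraph W) (τ : S ≃g S) (m : ℕ) : Prop :=
  -- `S` is connected, locally finite and quasi-transitive
  S.Connected ∧ IsLocallyFinite S ∧ ActsQuasiTransitively (⊤ : Subgroup (S ≃g S)) ∧
  -- `S` has precisely two ends, both of size `m`
  ∃ ωp ωm : GraphEnd S, ωp ≠ ωm ∧ (∀ ω : GraphEnd S, ω = ωp ∨ ω = ωm) ∧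
    ωp.IsThinOfSize m ∧ ωm.IsThinOfSize m ∧
    -- the images of a set `K` of `m` vertices under the powers of `τ` and of its inverse
    -- are defining sequences of the two ends
    ∃ K : Set W, K.Finite ∧ K.ncard = m ∧
      IsDefiningSequence ωp (fun n : ℕ => (τ ^ n) '' K) ∧
      IsDefiningSequence ωm (fun n : ℕ => (τ⁻¹ ^ n) '' K) ∧
      -- there are `m` disjoint `τ`-invariant double rays, each of which meets every
      -- image of `K` in precisely one vertex
      (∃ ρ : Fin m → DoubleRay S,
        (∀ i j, i ≠ j → Disjoint (Set.range (ρ i).vertex) (Set.range (ρ j).vertex)) ∧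
        (∀ i, (ρ i).toSubgraph.map τ.toHom = (ρ i).toSubgraph) ∧
        (∀ i, ∀ n : ℤ, ∃! v, v ∈ Set.range (ρ i).vertex ∧ v ∈ (τ ^ n) '' K)) ∧
      -- the part between `K` and `τ K` spans a finite connected subgraph
      ((K ∪ ωp.comp K) \ ωp.comp (τ '' K)).Finite ∧
      (S.induce ((K ∪ ωp.comp K) \ ωp.comp (τ '' K))).Connected

/-- The subgraph `S` of `G` is a `τ`-strip of size `m`, where `τ` is an automorphism of `G`:
`τ` restricts to an automorphism of `S` for which `S` is a strip of size `m`. -/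
def IsSubgraphStripOfSize (S : G.Subgraph) (τ : G ≃g G) (m : ℕ) : Prop :=
  ∃ σ : S.coe ≃g S.coe, (∀ v : S.verts, (σ v : V) = τ v) ∧ IsStripOfSize S.coe σ m

end GraphStrip

/-! Fewer than `m` vertices cannot cut late members of a defining sequence off a thin end of size
`m`: smaller separators occurring arbitrarily far out could be strung together into a defining
sequence with smaller members (`eventually_not_separated`). By Menger's theorem each late `K n` is
therefore linked to `K (n + 1)` by `m` disjoint paths in the part between them. These paths
concatenate to `m` disjoint rays, each meeting every `K n` exactly once
(`IsDefiningSequence.nonempty_raySystem`).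

A late `K n` is moreover a minimal separator of two neighbours of one of its vertices, namely the
successor and the predecessor of that vertex on its ray. A family of finite sets has only finitely
many minimal hitting sets of a given size (`finite_minimalHittingSet`). With local finiteness and
quasi-transitivity, only finitely many pairs of an enumerated separator and a successor remain up to
the action of `Γ`. The pigeonhole principle yields an `n` and arbitrarily late `l` with some `τ ∈ Γ`
that maps `K n` to `K l` along the rays and `C(K n, ω)` onto `C(K l, ω)`
(`RaySystem.exists_translations`).

Choose a finite connected set `F` in `C(K n, ω)` that touches all the rays, and then `l` so late
that `F` lies before `K l`. Together with the ray pieces from `K n` up to, but not including, `K l`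
it forms a finite segment. The translates of the segment under the powers of `τ` are disjoint and
are linked only through translates of `K n`, and the graph induced on their union is the strip. The
index of the translate is a height function, its two directions are the two ends, and the ray pieces
concatenate to `m` invariant double rays. The double rays bound the sizes of the ends from below,
the translates of `K n` from above (`StripSeed.stripData`, `StripData.isStripOfSize`). -/

namespace GraphStrip

universe u

variable {V : Type u} {G : SimpleGraph V}

/-! ### Connected vertex sets -/

/-- A nonempty vertex set that induces a connected subgraph, expressed by closure: a set which
meets `U` and is closed under adjacency inside `U` contains `U`. -/
def IsConnectedSet (G : SimpleGraph V) (U : Set V) : Prop :=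
  U.Nonempty ∧ ∀ Y : Set V, (U ∩ Y).Nonempty →
    (∀ a ∈ U, a ∈ Y → ∀ b ∈ U, G.Adj a b → b ∈ Y) → U ⊆ Y

theorem IsConnectedSet.induce_connected {U : Set V} (h : IsConnectedSet G U) :
    (G.induce U).Connected := by
  obtain ⟨⟨x, hx⟩, h⟩ := h
  have key : ∀ v ∈ U, ∃ hv : v ∈ U, (G.induce U).Reachable ⟨x, hx⟩ ⟨v, hv⟩ := by
    refine h {v | ∃ hv : v ∈ U, (G.induce U).Reachable ⟨x, hx⟩ ⟨v, hv⟩}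
      ⟨x, hx, hx, SimpleGraph.Reachable.refl _⟩ ?_
    rintro a ha ⟨_, hr⟩ b hb hab
    refine ⟨hb, hr.trans ?_⟩
    exact SimpleGraph.Adj.reachable (by simpa using hab)
  rw [SimpleGraph.connected_iff_exists_forall_reachable]
  exact ⟨⟨x, hx⟩, fun v => (key v v.2).2⟩

theorem isConnectedSet_univ (h : G.Connected) : IsConnectedSet G Set.univ := by
  obtain ⟨x⟩ := h.nonempty
  refine ⟨⟨x, trivial⟩, ?_⟩
  rintro Y ⟨y, -, hyY⟩ hcl v -
  have hr := h.preconnected y v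
  rw [SimpleGraph.reachable_iff_reflTransGen] at hr
  induction hr with
  | refl => exact hyY
  | tail _ hab ih => exact hcl _ trivial ih _ trivial hab

theorem IsConnectedSet.connected (h : IsConnectedSet G Set.univ) : G.Connected := by
  have := h.induce_connected
  exact (SimpleGraph.Iso.connected_iff (SimpleGraph.induceUnivIso G)).1 this

theorem isConnectedSet_singleton (v : V) : IsConnectedSet G {v} :=
  ⟨⟨v, rfl⟩, by rintro Y ⟨_, rfl, hy⟩ _ _ rfl; exact hy⟩

/-- Two vertex sets share a vertex or are joined by an edge. -/
def Touch (G : SimpleGraph V) (U U' : Set V) : Prop :=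
  ∃ a ∈ U, ∃ b ∈ U', a = b ∨ G.Adj a b

theorem IsConnectedSet.subset_of_touch {U T Y : Set V} (hU : IsConnectedSet G U) (hUT : U ⊆ T)
    (hcl : ∀ a ∈ T, a ∈ Y → ∀ b ∈ T, G.Adj a b → b ∈ Y) {A : Set V} (hAT : A ⊆ T) (hA : A ⊆ Y)
    (ht : Touch G A U) : U ⊆ Y := by
  obtain ⟨a, ha, b, hb, hab⟩ := ht
  have hbY : b ∈ Y := by
    rcases hab with rfl | hab
    · exact hA ha
    · exact hcl a (hAT ha) (hA ha) b (hUT hb) hab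
  exact hU.2 Y ⟨b, hb, hbY⟩ fun a ha haY b hb hab => hcl a (hUT ha) haY b (hUT hb) hab

theorem Touch.symm {U U' : Set V} (h : Touch G U U') : Touch G U' U := by
  obtain ⟨a, ha, b, hb, hab⟩ := h
  exact ⟨b, hb, a, ha, hab.imp Eq.symm fun h => h.symm⟩

theorem IsConnectedSet.subset_of_closed {U T Y : Set V} (hU : IsConnectedSet G U) (hUT : U ⊆ T)
    (hcl : ∀ a ∈ T, a ∈ Y → ∀ b ∈ T, G.Adj a b → b ∈ Y) {x : V} (hxU : x ∈ U) (hxY : x ∈ Y) :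
    U ⊆ Y :=
  hU.2 Y ⟨x, hxU, hxY⟩ fun a ha haY b hb hab => hcl a (hUT ha) haY b (hUT hb) hab

/-- A connected set together with connected sets touching it is connected. -/
theorem IsConnectedSet.union_iUnion {ι : Type*} {U : Set V} {A : ι → Set V}
    (hU : IsConnectedSet G U) (hA : ∀ i, IsConnectedSet G (A i)) (ht : ∀ i, Touch G U (A i)) :
    IsConnectedSet G (U ∪ ⋃ i, A i) := by
  refine ⟨hU.1.inl, ?_⟩
  rintro Y ⟨y, hy, hyY⟩ hcl
  have hAsub : ∀ i, A i ⊆ U ∪ ⋃ i, A i := fun i =>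
    (Set.subset_iUnion A i).trans Set.subset_union_right
  have hUY : U ⊆ Y := by
    rcases hy with hy | hy
    · exact hU.subset_of_closed Set.subset_union_left hcl hy hyY
    · obtain ⟨i, hi⟩ := Set.mem_iUnion.1 hy
      exact hU.subset_of_touch Set.subset_union_left hcl (hAsub i)
        ((hA i).subset_of_closed (hAsub i) hcl hi hyY) (ht i).symm
  refine Set.union_subset hUY (Set.iUnion_subset fun i => ?_)
  exact (hA i).subset_of_touch (hAsub i) hcl Set.subset_union_left hUY (ht i)

theorem IsConnectedSet.union {U A : Set V} (hU : IsConnectedSet G U) (hA : IsConnectedSet G A)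
    (ht : Touch G U A) : IsConnectedSet G (U ∪ A) := by
  have h := hU.union_iUnion (fun _ : Unit => hA) (fun _ => ht)
  rwa [Set.iUnion_const] at h

/-- A chain of connected sets, consecutive ones touching, has connected union. -/
theorem isConnectedSet_iUnion_chain {A : ℕ → Set V} (hA : ∀ n, IsConnectedSet G (A n))
    (ht : ∀ n, Touch G (A n) (A (n + 1))) : IsConnectedSet G (⋃ n, A n) := by
  refine ⟨(hA 0).1.mono (Set.subset_iUnion A 0), ?_⟩
  rintro Y ⟨y, hy, hyY⟩ hcl
  obtain ⟨k, hk⟩ := Set.mem_iUnion.1 hy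
  have hsub := Set.subset_iUnion A
  have hk' : A k ⊆ Y := (hA k).subset_of_closed (hsub k) hcl hk hyY
  have h0 : ∀ j ≤ k, A (k - j) ⊆ Y := by
    intro j
    induction j with
    | zero => exact fun _ => hk'
    | succ j ih =>
      intro hj
      refine (hA _).subset_of_touch (hsub _) hcl (hsub (k - j)) (ih (by omega)) ?_
      have := (ht (k - (j + 1))).symm
      rwa [show k - (j + 1) + 1 = k - j by omega] at this
  have h1 : ∀ n, A n ⊆ Y := by
    intro n
    induction n with
    | zero => simpa using h0 k le_rfl
    | succ n ih => exact (hA _).subset_of_touch (hsub _) hcl (hsub n) ih (ht n)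
  exact Set.iUnion_subset h1

/-- A finite chain of vertices, consecutive ones adjacent, is connected. -/
theorem isConnectedSet_path {p : ℕ → V} {a b : ℕ} (hab : a ≤ b)
    (hp : ∀ k, a ≤ k → k < b → G.Adj (p k) (p (k + 1))) :
    IsConnectedSet G (p '' Set.Icc a b) := by
  have h := isConnectedSet_iUnion_chain (G := G) (A := fun n => {p (min (a + n) b)})
    (fun n => isConnectedSet_singleton _) (fun n => ⟨_, rfl, _, rfl, by
      rcases lt_or_ge (a + n) b with h | h
      · right
        rw [min_eq_left h.le, min_eq_left (by omega)]
        exact hp _ (by omega) h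
      · left
        rw [min_eq_right h, min_eq_right (by omega)]⟩)
  convert h using 1
  ext v
  simp only [Set.mem_image, Set.mem_Icc, Set.mem_iUnion, Set.mem_singleton_iff]
  constructor
  · rintro ⟨k, ⟨h1, h2⟩, rfl⟩
    exact ⟨k - a, by rw [min_eq_left (by omega)]; congr 1; omega⟩
  · rintro ⟨n, rfl⟩
    exact ⟨min (a + n) b, ⟨by omega, by omega⟩, rfl⟩

theorem IsConnectedSet.exists_finite {U : Set V} (hU : IsConnectedSet G U) {x y : V}
    (hx : x ∈ U) (hy : y ∈ U) :
    ∃ Q : Set V, Q.Finite ∧ Q ⊆ U ∧ x ∈ Q ∧ y ∈ Q ∧ IsConnectedSet G Q := by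
  refine hU.2 {y | ∃ Q : Set V, Q.Finite ∧ Q ⊆ U ∧ x ∈ Q ∧ y ∈ Q ∧ IsConnectedSet G Q}
    ⟨x, hx, {x}, Set.finite_singleton x, by simpa using hx, rfl, rfl,
      isConnectedSet_singleton x⟩ ?_ hy
  rintro a ha ⟨Q, h1, h2, h3, h4, h5⟩ b hb hab
  refine ⟨Q ∪ {b}, h1.union (Set.finite_singleton b),
    Set.union_subset h2 (by simpa using hb), Or.inl h3, Or.inr rfl, ?_⟩
  exact h5.union (isConnectedSet_singleton b) ⟨a, h4, b, rfl, Or.inr hab⟩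

/-- A finite subset of a connected set lies in a finite connected subset. -/
theorem IsConnectedSet.exists_finite_superset {ι : Type*} [Finite ι] {U : Set V}
    (hU : IsConnectedSet G U) {x : ι → V} (hx : ∀ i, x i ∈ U) :
    ∃ Q : Set V, Q.Finite ∧ Q ⊆ U ∧ (∀ i, x i ∈ Q) ∧ IsConnectedSet G Q := by
  obtain ⟨x₀, hx₀⟩ := hU.1
  choose Q h1 h2 h3 h4 h5 using fun i => hU.exists_finite hx₀ (hx i)
  refine ⟨{x₀} ∪ ⋃ i, Q i, (Set.finite_singleton _).union (Set.finite_iUnion h1),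
    Set.union_subset (by simpa using hx₀) (Set.iUnion_subset h2),
    fun i => Or.inr (Set.mem_iUnion.2 ⟨i, h4 i⟩), ?_⟩
  exact (isConnectedSet_singleton x₀).union_iUnion h5 fun i => ⟨x₀, rfl, x₀, h3 i, Or.inl rfl⟩

theorem IsConnectedSet.image {W : Type*} {H : SimpleGraph W} {U : Set V}
    (hU : IsConnectedSet G U) {f : V → W} (hf : ∀ a b, G.Adj a b → H.Adj (f a) (f b)) :
    IsConnectedSet H (f '' U) := by
  refine ⟨hU.1.image f, ?_⟩
  rintro Y ⟨_, ⟨y, hy, rfl⟩, hyY⟩ hcl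
  rintro _ ⟨v, hv, rfl⟩
  exact hU.2 (f ⁻¹' Y) ⟨y, hy, hyY⟩
    (fun a ha haY b hb hab => hcl _ ⟨a, ha, rfl⟩ haY _ ⟨b, hb, rfl⟩ (hf a b hab)) hv

theorem IsConnectedSet.preimage {W : Type*} {H : SimpleGraph W} {U : Set V}
    (hU : IsConnectedSet G U) {f : W → V} (hf : ∀ a b, G.Adj (f a) (f b) → H.Adj a b)
    (hsurj : U ⊆ Set.range f) (hinj : Function.Injective f) :
    IsConnectedSet H (f ⁻¹' U) := by
  obtain ⟨⟨x, hx⟩, hU⟩ := hU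
  obtain ⟨w, rfl⟩ := hsurj hx
  refine ⟨⟨w, hx⟩, ?_⟩
  rintro Y ⟨y, hy, hyY⟩ hcl v hv
  have := hU (f '' Y) ⟨f y, hy, y, hyY, rfl⟩ (by
    rintro _ ha ⟨a, haY, rfl⟩ b hb hab
    obtain ⟨b, rfl⟩ := hsurj hb
    exact ⟨b, hcl a ha haY b hb (hf _ _ hab), rfl⟩) hv
  obtain ⟨z, hz, hzv⟩ := this
  rwa [← hinj hzv]

/-! ### The components `C(K, ω)` -/

theorem isConnectedSet_componentCompl {K : Set V} (C : G.ComponentCompl K) :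
    IsConnectedSet G (C : Set V) := by
  refine ⟨C.nonempty, ?_⟩
  rintro Y ⟨y, ⟨hyK, hyC⟩, hyY⟩ hcl v ⟨hvK, hvC⟩
  have hr : (G.induce Kᶜ).Reachable ⟨y, hyK⟩ ⟨v, hvK⟩ :=
    SimpleGraph.ConnectedComponent.exact (hyC.trans hvC.symm)
  rw [SimpleGraph.reachable_iff_reflTransGen] at hr
  have : ∀ w : ↥(Kᶜ), Relation.ReflTransGen (G.induce Kᶜ).Adj ⟨y, hyK⟩ w →
      (w : V) ∈ C ∧ (w : V) ∈ Y := by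
    intro w hw
    induction hw with
    | refl => exact ⟨⟨hyK, hyC⟩, hyY⟩
    | @tail b c _ hab ih =>
      have hadj : G.Adj (b : V) c := by simpa using hab
      have hc : (c : V) ∈ C := SimpleGraph.ComponentCompl.mem_of_adj _ _ ih.1 c.2 hadj
      exact ⟨hc, hcl _ ih.1 ih.2 _ hc hadj⟩
  exact (this _ hr).2

theorem GraphEnd.exists_ray (ω : GraphEnd G) : ∃ r : Ray G, r.toEnd = ω :=
  Quotient.exists_rep ω

section Comp

variable {ω : GraphEnd G} {K : Set V}

theorem GraphEnd.exists_comp_eq (ω : GraphEnd G) (hK : K.Finite) :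
    ∃ C : G.ComponentCompl K, ω.comp K = C ∧ ∀ r : Ray G, r.toEnd = ω → r.EndsUpIn C := by
  obtain ⟨r, rfl⟩ := ω.exists_ray
  obtain ⟨C, hC⟩ := r.exists_endsUpIn hK
  refine ⟨C, hC.comp_toEnd hK, fun s hs => ?_⟩
  obtain ⟨D, h₁, h₂⟩ := (Quotient.exact hs : Ray.Equivalent s r) K hK
  obtain rfl := h₂.unique hC
  exact h₁

theorem GraphEnd.isConnectedSet_comp (ω : GraphEnd G) (hK : K.Finite) :
    IsConnectedSet G (ω.comp K) := by
  obtain ⟨C, hC, -⟩ := ω.exists_comp_eq hK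
  rw [hC]
  exact isConnectedSet_componentCompl C

theorem GraphEnd.notMem_of_mem_comp {v : V} (hv : v ∈ ω.comp K) : v ∉ K := by
  obtain ⟨C, ⟨h, -⟩, -⟩ := hv
  exact h

theorem GraphEnd.mem_comp_of_adj {a b : V} (ha : a ∈ ω.comp K)
    (hb : b ∉ K) (hab : G.Adj a b) : b ∈ ω.comp K := by
  obtain ⟨C, haC, hC⟩ := ha
  exact ⟨C, SimpleGraph.ComponentCompl.mem_of_adj _ _ haC hb hab, hC⟩

theorem Ray.eventually_mem_comp (r : Ray G) (hr : r.toEnd = ω) (hK : K.Finite) :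
    ∃ N, ∀ n, N ≤ n → r.vertex n ∈ ω.comp K := by
  obtain ⟨C, hC, h⟩ := ω.exists_comp_eq hK
  obtain ⟨N, hN⟩ := h r hr
  exact ⟨N, fun n hn => by rw [hC]; exact hN n hn⟩

theorem IsConnectedSet.subset_comp {U : Set V} (hU : IsConnectedSet G U)
    (hUK : ∀ v ∈ U, v ∉ K) {x : V} (hx : x ∈ U) (hxC : x ∈ ω.comp K) : U ⊆ ω.comp K :=
  hU.2 _ ⟨x, hx, hxC⟩ fun _ _ haC b hb hab => ω.mem_comp_of_adj haC (hUK b hb) hab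

/-- Such a `U` is a full component of `G \ K`, so one common vertex suffices for equality. All
components `C(K, ω)` of the strip are computed in this way. -/
theorem comp_eq_of_mem (hK : K.Finite) {U : Set V} (hU : IsConnectedSet G U)
    (hUK : ∀ v ∈ U, v ∉ K) (hcl : ∀ a ∈ U, ∀ b, G.Adj a b → b ∉ K → b ∈ U)
    {x : V} (hxU : x ∈ U) (hxC : x ∈ ω.comp K) : ω.comp K = U := by
  refine Set.Subset.antisymm ?_ (hU.subset_comp hUK hxU hxC)
  exact (ω.isConnectedSet_comp hK).2 U ⟨x, hxC, hxU⟩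
    fun a _ haU b hb hab => hcl a haU b hab (GraphEnd.notMem_of_mem_comp hb)

theorem Ray.comp_eq (r : Ray G) (hr : r.toEnd = ω) (hK : K.Finite) {U : Set V}
    (hU : IsConnectedSet G U) (hUK : ∀ v ∈ U, v ∉ K)
    (hcl : ∀ a ∈ U, ∀ b, G.Adj a b → b ∉ K → b ∈ U)
    {N : ℕ} (hN : ∀ n, N ≤ n → r.vertex n ∈ U) : ω.comp K = U := by
  obtain ⟨M, hM⟩ := r.eventually_mem_comp hr hK
  exact comp_eq_of_mem hK hU hUK hcl (hN (max N M) (le_max_left _ _))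
    (hM (max N M) (le_max_right _ _))

theorem Ray.toEnd_eq {r s : Ray G}
    (h : ∀ K : Set V, K.Finite → ∃ U : Set V, IsConnectedSet G U ∧ (∀ v ∈ U, v ∉ K) ∧
      (∃ N, ∀ n, N ≤ n → r.vertex n ∈ U) ∧ ∃ N, ∀ n, N ≤ n → s.vertex n ∈ U) :
    r.toEnd = s.toEnd := by
  refine Quotient.sound fun K hK => ?_
  obtain ⟨U, hU, hUK, ⟨N, hN⟩, M, hM⟩ := h K hK
  obtain ⟨C, hC, hCr⟩ := r.toEnd.exists_comp_eq hK
  obtain ⟨N', hN'⟩ := hCr r rfl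
  have hsub : U ⊆ C := by
    rw [← hC]
    refine hU.subset_comp hUK (hN (max N N') (le_max_left _ _)) ?_
    rw [hC]
    exact hN' _ (le_max_right _ _)
  exact ⟨C, hCr r rfl, M, fun n hn => hsub (hM n hn)⟩

end Comp

/-! ### Defining sequences -/

section Defining

variable {ω : GraphEnd G} {K : ℕ → Set V}

theorem IsDefiningSequence.union_subset_comp (hK : IsDefiningSequence ω K) {n k : ℕ}
    (hnk : n < k) : K k ∪ ω.comp (K k) ⊆ ω.comp (K n) := by
  induction k, hnk using Nat.le_induction with
  | base => exact hK.2 n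
  | succ k _ ih => exact (hK.2 k).trans (Set.subset_union_right.trans ih)

theorem IsDefiningSequence.antitone (hK : IsDefiningSequence ω K) {n k : ℕ} (hnk : n ≤ k) :
    K k ∪ ω.comp (K k) ⊆ K n ∪ ω.comp (K n) := by
  rcases hnk.eq_or_lt with rfl | h
  · exact subset_rfl
  · exact (hK.union_subset_comp h).trans Set.subset_union_right

theorem IsDefiningSequence.mem_pred (hK : IsDefiningSequence ω K) {n : ℕ} {a b : V}
    (ha : a ∈ K (n + 1) ∪ ω.comp (K (n + 1))) (hab : G.Adj a b) :
    b ∈ K n ∪ ω.comp (K n) := by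
  by_cases hb : b ∈ K n
  · exact Or.inl hb
  · exact Or.inr (GraphEnd.mem_comp_of_adj (hK.2 n ha) hb hab)

/-- In a connected graph, every vertex is eventually separated from the end. -/
theorem IsDefiningSequence.eventually_notMem (hG : G.Connected) (hK : IsDefiningSequence ω K)
    (v : V) : ∃ N, ∀ n, N ≤ n → v ∉ K n ∪ ω.comp (K n) := by
  suffices h : ∃ N, v ∉ K N ∪ ω.comp (K N) by
    obtain ⟨N, hN⟩ := h
    exact ⟨N, fun n hn hv => hN (hK.antitone hn hv)⟩
  obtain ⟨x, hx⟩ := (hK.1 0).2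
  -- The vertices that drop out at some index are closed under adjacency, a neighbour following at
  -- most one index later; the vertices of `K 0` drop out at index 1.
  refine (isConnectedSet_univ hG).2 {v | ∃ N, v ∉ K N ∪ ω.comp (K N)}
    ⟨x, trivial, 1, fun h => GraphEnd.notMem_of_mem_comp (hK.2 0 h) hx⟩ ?_ (Set.mem_univ v)
  rintro a - ⟨N, hN⟩ b - hab
  exact ⟨N + 1, fun hb => hN (hK.mem_pred hb hab.symm)⟩

theorem IsDefiningSequence.eventually_disjoint (hG : G.Connected) (hK : IsDefiningSequence ω K)
    {F : Set V} (hF : F.Finite) : ∃ N, ∀ n, N ≤ n → ∀ v ∈ F, v ∉ K n ∪ ω.comp (K n) := by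
  choose N hN using hK.eventually_notMem hG
  obtain ⟨M, hM⟩ := (hF.image N).bddAbove
  exact ⟨M, fun n hn v hv => hN v n ((hM ⟨v, hv, rfl⟩).trans hn)⟩

theorem IsDefiningSequence.comp (hK : IsDefiningSequence ω K) {φ : ℕ → ℕ} (hφ : StrictMono φ) :
    IsDefiningSequence ω (K ∘ φ) :=
  ⟨fun _ => hK.1 _, fun n => hK.union_subset_comp (hφ n.lt_succ_self)⟩

/-- Disjoint rays of an end bound the sizes of the members of a defining sequence from below. -/
theorem IsDefiningSequence.exists_le_ncard (hG : G.Connected) (hK : IsDefiningSequence ω K)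
    {m : ℕ} (r : Fin m → Ray G) (hr : ∀ i, (r i).toEnd = ω)
    (hdisj : ∀ i j k l, (r i).vertex k = (r j).vertex l → i = j) :
    ∃ n, m ≤ (K n).ncard := by
  obtain ⟨N, hN⟩ := hK.eventually_disjoint hG (Set.finite_range fun i => (r i).vertex 0)
  -- Each ray starts outside `K N ∪ C(K N, ω)` and ends up inside `C(K N, ω)`, so it has to pass
  -- through `K N`.
  have key : ∀ i, ∃ k, (r i).vertex k ∈ K N := by
    intro i
    by_contra! hcon
    obtain ⟨M, hM⟩ := (r i).eventually_mem_comp (hr i) (hK.1 N).1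
    have : ∀ k, (r i).vertex k ∉ ω.comp (K N) := by
      intro k
      induction k with
      | zero => exact fun h => hN N le_rfl _ ⟨i, rfl⟩ (Or.inr h)
      | succ k ih =>
        exact fun h => ih (GraphEnd.mem_comp_of_adj h (hcon k) ((r i).adj k).symm)
    exact this M (hM M le_rfl)
  choose k hk using key
  refine ⟨N, ?_⟩
  have hinj : Function.Injective fun i => (r i).vertex (k i) := fun i j h => hdisj _ _ _ _ h
  have := Set.ncard_le_ncard (s := Set.range fun i => (r i).vertex (k i)) (t := K N)
    (by rintro _ ⟨i, rfl⟩; exact hk i) (hK.1 N).1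
  rwa [← Set.image_univ, Set.ncard_image_of_injective _ hinj, Set.ncard_univ,
    Nat.card_fin] at this

end Defining

/-! ### Graphs layered by a height function -/

/-- A graph with an automorphism `σ` shifting a height function by one, finite layers, and
`m` disjoint paths leading from the gate `K = range e` in layer `0` to the gate `σ K` in
layer `1`, such that layers are only linked through the gates. -/
structure StripData {W : Type u} (S : SimpleGraph W) (σ : S ≃g S) (m : ℕ) where
  pos : 0 < m
  h : W → ℤ
  e : Fin m → W
  h_apply : ∀ v, h (σ v) = h v + 1
  finite_layer : {v | h v = 0}.Finite
  h_gate : ∀ i, h (e i) = 0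
  gate_of_adj : ∀ u v, S.Adj u v → h u < h v → h v = h u + 1 ∧ ∃ i, v = (σ ^ h v) (e i)
  connected_layer : IsConnectedSet S {v | h v = 0}
  connected_upper : IsConnectedSet S (({v | h v = 0} \ Set.range e) ∪ σ '' Set.range e)
  p : Fin m → ℕ → W
  len : Fin m → ℕ
  len_pos : ∀ i, 0 < len i
  p_zero : ∀ i, p i 0 = e i
  p_len : ∀ i, p i (len i) = σ (e i)
  p_adj : ∀ i k, k < len i → S.Adj (p i k) (p i (k + 1))
  h_p : ∀ i k, k < len i → h (p i k) = 0
  p_inj : ∀ i j k l, k < len i → l < len j → p i k = p j l → i = j ∧ k = l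

namespace StripData

variable {W : Type u} {S : SimpleGraph W} {σ : S ≃g S} {m : ℕ} (D : StripData S σ m)

theorem e_injective : Function.Injective D.e := fun i j hij =>
  (D.p_inj i j 0 0 (D.len_pos i) (D.len_pos j) (by rw [D.p_zero, D.p_zero, hij])).1

theorem h_zpow (n : ℤ) (v : W) : D.h ((σ ^ n) v) = D.h v + n := by
  induction n with
  | zero => simp
  | succ n ih => rw [add_comm (n : ℤ) 1, zpow_add, zpow_one, RelIso.mul_apply, D.h_apply, ih]; ring
  | pred n ih =>
    have : D.h (σ ((σ ^ (-(n : ℤ) - 1)) v)) = D.h v + -n := by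
      rw [← ih, ← RelIso.mul_apply, ← zpow_one_add]; congr 3; ring
    rw [D.h_apply] at this
    linarith

theorem adj_zpow (n : ℤ) {a b : W} (hab : S.Adj a b) : S.Adj ((σ ^ n) a) ((σ ^ n) b) :=
  (σ ^ n).map_rel_iff.2 hab

theorem zpow_zpow_neg (n : ℤ) (v : W) : (σ ^ n) ((σ ^ (-n)) v) = v := by
  rw [← RelIso.mul_apply, ← zpow_add]; simp

/-- The translate `σⁿ K` of the gate. -/
def gate (n : ℤ) : Set W := (σ ^ n) '' Set.range D.e

theorem h_of_mem_gate {n : ℤ} {v : W} (hv : v ∈ D.gate n) : D.h v = n := by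
  obtain ⟨_, ⟨i, rfl⟩, rfl⟩ := hv
  rw [D.h_zpow, D.h_gate, zero_add]

theorem finite_gate (n : ℤ) : (D.gate n).Finite := (Set.finite_range _).image _

theorem gate_zero : D.gate 0 = Set.range D.e := by
  ext v
  simp [gate]

theorem mem_gate (n : ℤ) (i : Fin m) : (σ ^ n) (D.e i) ∈ D.gate n := ⟨_, ⟨i, rfl⟩, rfl⟩

theorem ncard_gate (n : ℤ) : (D.gate n).ncard = m := by
  rw [gate, Set.ncard_image_of_injective _ (σ ^ n).injective, ← Set.image_univ,
    Set.ncard_image_of_injective _ D.e_injective, Set.ncard_univ, Nat.card_fin]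

theorem layer_eq (n : ℤ) : {v | D.h v = n} = (σ ^ n) '' {v | D.h v = 0} := by
  ext v
  constructor
  · rintro rfl
    exact ⟨(σ ^ (-D.h v)) v, (D.h_zpow _ _).trans (add_neg_cancel _), zpow_zpow_neg _ _⟩
  · rintro ⟨w, hw, rfl⟩
    simp only [Set.mem_ofPred_eq] at hw ⊢
    rw [D.h_zpow, hw, zero_add]

theorem finite_layer' (n : ℤ) : {v | D.h v = n}.Finite := by
  rw [D.layer_eq]
  exact D.finite_layer.image _

theorem connected_layer' (n : ℤ) : IsConnectedSet S {v | D.h v = n} := by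
  rw [D.layer_eq]
  exact D.connected_layer.image fun a b => adj_zpow n

theorem finite_between (a b : ℤ) : {v | a ≤ D.h v ∧ D.h v ≤ b}.Finite := by
  refine ((Set.finite_Icc a b).biUnion fun n _ => D.finite_layer' n).subset ?_
  intro v hv
  simpa using hv

/-- The first index, used as a reference path. -/
def i₀ : Fin m := ⟨0, D.pos⟩

theorem exists_adj_gate (n : ℤ) (i : Fin m) :
    ∃ a, D.h a = n ∧ S.Adj a ((σ ^ (n + 1)) (D.e i)) := by
  have h1 := D.p_adj i (D.len i - 1) (by have := D.len_pos i; omega)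
  rw [Nat.sub_add_cancel (D.len_pos i), D.p_len] at h1
  refine ⟨(σ ^ n) (D.p i (D.len i - 1)), ?_, ?_⟩
  · rw [D.h_zpow, D.h_p _ _ (by have := D.len_pos i; omega), zero_add]
  · rw [zpow_add_one, RelIso.mul_apply]
    exact adj_zpow n h1

theorem touch_layer (n : ℤ) : Touch S {v | D.h v = n} {v | D.h v = n + 1} := by
  obtain ⟨a, ha, hab⟩ := D.exists_adj_gate n D.i₀
  exact ⟨a, ha, _, by simp [D.h_zpow, D.h_gate], Or.inr hab⟩

/-- The part above the gate `σⁿ K`. -/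
def upper (n : ℤ) : Set W := {v | n ≤ D.h v} \ D.gate n

/-- The part below the gate `σⁿ K`. -/
def lower (n : ℤ) : Set W := {v | D.h v < n}

/-- The gate lies in its own layer, so the part above it begins with an incomplete layer. The field
`connected_upper` joins this layer to the next gate, after which complete layers form a chain. Below
a gate all layers are complete. -/
theorem connected_upper' (n : ℤ) : IsConnectedSet S (D.upper n) := by
  have hchain := isConnectedSet_iUnion_chain (G := S)
    (A := fun k : ℕ => if k = 0 then
      (σ ^ n) '' (({v | D.h v = 0} \ Set.range D.e) ∪ σ '' Set.range D.e)
      else {v | D.h v = n + k}) (by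
      intro k
      split_ifs
      · exact D.connected_upper.image fun a b => adj_zpow n
      · exact D.connected_layer' _) (by
      intro k
      rcases k with - | k
      · refine ⟨(σ ^ n) (σ (D.e D.i₀)), by simp, (σ ^ n) (σ (D.e D.i₀)), ?_, Or.inl rfl⟩
        simp [D.h_zpow, D.h_apply, D.h_gate, add_comm]
      · simpa [add_assoc] using D.touch_layer (n + (k + 1)))
  convert hchain using 1
  ext v
  simp only [upper, Set.mem_sdiff, Set.mem_ofPred_eq, Set.mem_iUnion]
  constructor
  · rintro ⟨h1, h2⟩
    rcases h1.eq_or_lt with h1 | h1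
    · refine ⟨0, ?_⟩
      rw [if_pos rfl]
      refine ⟨(σ ^ (-n)) v, Or.inl ⟨?_, ?_⟩, zpow_zpow_neg _ _⟩
      · exact (D.h_zpow _ _).trans (by omega)
      · intro h3
        exact h2 ⟨_, h3, zpow_zpow_neg _ _⟩
    · refine ⟨(D.h v - n).toNat, ?_⟩
      rw [if_neg (by omega)]
      simp only [Set.mem_ofPred_eq]
      omega
  · rintro ⟨k, hk⟩
    split_ifs at hk with hk0
    · obtain ⟨w, ⟨hw, hwe⟩ | ⟨_, ⟨i, rfl⟩, rfl⟩, rfl⟩ := hk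
      · simp only [Set.mem_ofPred_eq] at hw
        refine ⟨by rw [D.h_zpow, hw, zero_add], ?_⟩
        rintro ⟨w', hw', h⟩
        rw [(σ ^ n).injective h] at hw'
        exact hwe hw'
      · have h1 : D.h ((σ ^ n) (σ (D.e i))) = n + 1 := by
          rw [D.h_zpow, D.h_apply, D.h_gate]; ring
        refine ⟨by omega, fun h => ?_⟩
        have := D.h_of_mem_gate h
        omega
    · simp only [Set.mem_ofPred_eq] at hk
      refine ⟨by omega, fun h => ?_⟩
      have := D.h_of_mem_gate h
      omega

theorem connected_lower (n : ℤ) : IsConnectedSet S (D.lower n) := by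
  have hchain := isConnectedSet_iUnion_chain (G := S)
    (A := fun k : ℕ => {v | D.h v = n - 1 - k}) (fun k => D.connected_layer' _) (fun k => by
      have := (D.touch_layer (n - 1 - (k + 1))).symm
      rw [show n - 1 - ((k : ℤ) + 1) + 1 = n - 1 - k by ring] at this
      exact_mod_cast this)
  convert hchain using 1
  ext v
  simp only [lower, Set.mem_ofPred_eq, Set.mem_iUnion]
  constructor
  · intro h
    exact ⟨(n - 1 - D.h v).toNat, by omega⟩
  · rintro ⟨k, hk⟩
    omega

/-- An edge leading from height at least `n` to below `n` has its upper end in the gate, which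
`upper` excludes. -/
theorem upper_closed (n : ℤ) : ∀ a ∈ D.upper n, ∀ b, S.Adj a b → b ∉ D.gate n → b ∈ D.upper n := by
  rintro a ⟨ha, ha'⟩ b hab hb
  refine ⟨?_, hb⟩
  by_contra hlt
  simp only [Set.mem_ofPred_eq] at ha hlt
  obtain ⟨h1, i, h2⟩ := D.gate_of_adj b a hab.symm (by omega)
  apply ha'
  rw [h2, show D.h a = n by omega]
  exact D.mem_gate n i

theorem lower_closed (n : ℤ) : ∀ a ∈ D.lower n, ∀ b, S.Adj a b → b ∉ D.gate n → b ∈ D.lower n := by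
  intro a ha b hab hb
  by_contra hlt
  simp only [lower, Set.mem_ofPred_eq] at ha hlt
  obtain ⟨h1, i, h2⟩ := D.gate_of_adj a b hab (by omega)
  apply hb
  rw [h2, show D.h b = n by omega]
  exact D.mem_gate n i

theorem lower_notMem_gate (n : ℤ) : ∀ v ∈ D.lower n, v ∉ D.gate n := by
  intro v hv hv'
  have := D.h_of_mem_gate hv'
  simp only [lower, Set.mem_ofPred_eq] at hv
  omega

/-! ### The double rays -/

/-- The `n`-th vertex of the double ray obtained from the translates of the `i`-th path. -/
def vertex (i : Fin m) (n : ℤ) : W := (σ ^ (n / D.len i)) (D.p i (n % D.len i).toNat)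

theorem len_pos' (i : Fin m) : (0 : ℤ) < D.len i := by exact_mod_cast D.len_pos i

theorem emod_toNat_lt (i : Fin m) (n : ℤ) : (n % D.len i).toNat < D.len i := by
  have h1 := Int.emod_lt_of_pos n (D.len_pos' i)
  have h2 := Int.emod_nonneg n (D.len_pos' i).ne'
  omega

theorem h_vertex (i : Fin m) (n : ℤ) : D.h (D.vertex i n) = n / D.len i := by
  rw [vertex, D.h_zpow, D.h_p _ _ (D.emod_toNat_lt i n), zero_add]

/-- The height recovers the quotient, hence both vertices come from the same translate, and `p_inj`
compares the remainders. -/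
theorem vertex_inj {i j : Fin m} {n k : ℤ} (h : D.vertex i n = D.vertex j k) :
    i = j ∧ n = k := by
  have h1 : n / D.len i = k / D.len j := by rw [← D.h_vertex, ← D.h_vertex, h]
  rw [vertex, vertex, h1] at h
  obtain ⟨rfl, h2⟩ := D.p_inj _ _ _ _ (D.emod_toNat_lt i n) (D.emod_toNat_lt j k)
    ((σ ^ (k / D.len j)).injective h)
  refine ⟨rfl, ?_⟩
  have h3 := Int.emod_nonneg n (D.len_pos' i).ne'
  have h4 := Int.emod_nonneg k (D.len_pos' i).ne'
  rw [← Int.mul_ediv_add_emod n (D.len i), ← Int.mul_ediv_add_emod k (D.len i), h1]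
  omega

theorem vertex_add_len (i : Fin m) (n : ℤ) : D.vertex i (n + D.len i) = σ (D.vertex i n) := by
  rw [vertex, vertex, Int.add_ediv_of_dvd_right (dvd_refl _), Int.ediv_self (D.len_pos' i).ne',
    Int.add_emod_right,
    add_comm (n / _) 1, zpow_one_add, RelIso.mul_apply]

theorem vertex_adj (i : Fin m) (n : ℤ) : S.Adj (D.vertex i n) (D.vertex i (n + 1)) := by
  have hL := D.len_pos' i
  have h2 := Int.emod_nonneg n hL.ne'
  have hlt := D.emod_toNat_lt i n
  have hadj := adj_zpow (σ := σ) (n / D.len i) (D.p_adj i _ hlt)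
  have hn := Int.mul_ediv_add_emod n (D.len i)
  -- Either `n + 1` stays on the same translate of the path, or the remainder wraps to 0 and the end
  -- of one translate is the start of the next.
  have : D.vertex i (n + 1) = (σ ^ (n / D.len i)) (D.p i ((n % D.len i).toNat + 1)) := by
    rcases lt_or_ge (n % D.len i + 1) (D.len i) with hc | hc
    · have h3 : (n + 1) / D.len i = n / D.len i ∧ (n + 1) % D.len i = n % D.len i + 1 := by
        rw [Int.ediv_emod_unique hL]
        exact ⟨by linarith, by omega, hc⟩
      rw [vertex, h3.1, h3.2]
      congr 2
      omega
    · have h3 : (n + 1) / D.len i = n / D.len i + 1 ∧ (n + 1) % D.len i = 0 := by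
        rw [Int.ediv_emod_unique hL]
        refine ⟨?_, le_rfl, hL⟩
        rw [mul_add, mul_one]
        omega
      rw [vertex, h3.1, h3.2, show (n % D.len i).toNat + 1 = D.len i by omega, D.p_len,
        zpow_add_one, RelIso.mul_apply]
      simp [D.p_zero]
  rw [this]
  exact hadj

theorem vertex_mul_len (i : Fin m) (n : ℤ) : D.vertex i (n * D.len i) = (σ ^ n) (D.e i) := by
  rw [vertex, Int.mul_ediv_cancel _ (D.len_pos' i).ne', Int.mul_emod_left]
  simp [D.p_zero]

theorem vertex_mem_gate {i : Fin m} {n k : ℤ} (h : D.vertex i n ∈ D.gate k) :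
    D.vertex i n = (σ ^ k) (D.e i) := by
  obtain ⟨_, ⟨j, rfl⟩, h⟩ := h
  rw [← D.vertex_mul_len] at h
  obtain ⟨rfl, h2⟩ := D.vertex_inj h
  rw [← D.vertex_mul_len, h2]

/-- The double ray formed by the translates of the `i`-th path. -/
def doubleRay (i : Fin m) : DoubleRay S where
  vertex := D.vertex i
  injective _ _ h := (D.vertex_inj h).2
  adj := D.vertex_adj i

theorem map_doubleRay (i : Fin m) :
    (D.doubleRay i).toSubgraph.map σ.toHom = (D.doubleRay i).toSubgraph := by
  have hback : ∀ n, D.vertex i n = σ (D.vertex i (n - D.len i)) := fun n => by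
    rw [← D.vertex_add_len, sub_add_cancel]
  ext a b
  · simp only [SimpleGraph.Subgraph.map_verts, DoubleRay.toSubgraph, doubleRay]
    constructor
    · rintro ⟨_, ⟨n, rfl⟩, rfl⟩
      exact ⟨n + D.len i, D.vertex_add_len i n⟩
    · rintro ⟨n, rfl⟩
      exact ⟨_, ⟨n - D.len i, rfl⟩, (hback n).symm⟩
  · simp only [SimpleGraph.Subgraph.map_adj, DoubleRay.toSubgraph, doubleRay, Relation.Map]
    constructor
    · rintro ⟨_, _, ⟨n, ⟨rfl, rfl⟩ | ⟨rfl, rfl⟩⟩, rfl, rfl⟩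
      · refine ⟨n + D.len i, Or.inl ⟨(D.vertex_add_len i n).symm, ?_⟩⟩
        rw [add_right_comm]
        exact (D.vertex_add_len i _).symm
      · refine ⟨n + D.len i, Or.inr ⟨(D.vertex_add_len i n).symm, ?_⟩⟩
        rw [add_right_comm]
        exact (D.vertex_add_len i _).symm
    · rintro ⟨n, h⟩
      have h1 := hback n
      have h2 := hback (n + 1)
      rw [show n + 1 - D.len i = n - D.len i + 1 by ring] at h2
      rcases h with ⟨rfl, rfl⟩ | ⟨rfl, rfl⟩
      · exact ⟨_, _, ⟨n - D.len i, Or.inl ⟨rfl, rfl⟩⟩, h1.symm, h2.symm⟩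
      · exact ⟨_, _, ⟨n - D.len i, Or.inr ⟨rfl, rfl⟩⟩, h2.symm, h1.symm⟩

/-! ### The two ends -/

/-- The ascending half of a double ray. -/
def posRay (i : Fin m) : Ray S where
  vertex n := D.vertex i n
  injective a b h := by exact_mod_cast (D.vertex_inj h).2
  adj n := by exact_mod_cast D.vertex_adj i n

/-- The descending half of a double ray. -/
def negRay (i : Fin m) : Ray S where
  vertex n := D.vertex i (-n)
  injective a b h := by have := (D.vertex_inj h).2; omega
  adj n := by
    have := (D.vertex_adj i (-(n + 1 : ℕ))).symm
    rwa [show -((n + 1 : ℕ) : ℤ) + 1 = -n by omega] at this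

/-- The heights along a ray eventually leave every bounded interval. -/
theorem ray_abs_gt (r : Ray S) (M : ℤ) : ∃ N, ∀ n, N ≤ n → M < |D.h (r.vertex n)| := by
  have hfin := (D.finite_between (-M) M).preimage r.injective.injOn
  obtain ⟨N, hN⟩ := hfin.bddAbove
  refine ⟨N + 1, fun n hn => ?_⟩
  by_contra! hle
  have : n ≤ N := hN (abs_le.1 hle)
  omega

theorem h_adj {a b : W} (hab : S.Adj a b) : D.h b ≤ D.h a + 1 := by
  by_contra! hlt
  have := (D.gate_of_adj a b hab (by omega)).1
  omega

/-- Bands of bounded height are finite, so the height tends to infinity in absolute value along a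
ray. It changes by at most one per edge, so once it avoids 0 its sign is fixed. -/
theorem ray_cases (r : Ray S) :
    (∀ M : ℤ, ∃ N, ∀ n, N ≤ n → M < D.h (r.vertex n)) ∨
      (∀ M : ℤ, ∃ N, ∀ n, N ≤ n → D.h (r.vertex n) < M) := by
  obtain ⟨N, hN⟩ := D.ray_abs_gt r 0
  have hne : ∀ n, N ≤ n → D.h (r.vertex n) ≠ 0 := fun n hn => abs_pos.1 (hN n hn)
  rcases lt_or_gt_of_ne (hne N le_rfl) with hlt | hgt
  · right
    have hneg : ∀ n, N ≤ n → D.h (r.vertex n) < 0 := by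
      intro n hn
      induction n, hn using Nat.le_induction with
      | base => exact hlt
      | succ n hn ih =>
        have h1 := D.h_adj (r.adj n)
        have h2 := hne (n + 1) (by omega)
        omega
    intro M
    obtain ⟨N', hN'⟩ := D.ray_abs_gt r |M|
    refine ⟨max N N', fun n hn => ?_⟩
    have h1 := hN' n ((le_max_right _ _).trans hn)
    rw [abs_of_neg (hneg n ((le_max_left _ _).trans hn))] at h1
    have := neg_abs_le M
    linarith
  · left
    have hpos : ∀ n, N ≤ n → 0 < D.h (r.vertex n) := by
      intro n hn
      induction n, hn using Nat.le_induction with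
      | base => exact hgt
      | succ n hn ih =>
        have h1 := D.h_adj (r.adj n).symm
        have h2 := hne (n + 1) (by omega)
        omega
    intro M
    obtain ⟨N', hN'⟩ := D.ray_abs_gt r |M|
    refine ⟨max N N', fun n hn => ?_⟩
    have h1 := hN' n ((le_max_right _ _).trans hn)
    rw [abs_of_pos (hpos n ((le_max_left _ _).trans hn))] at h1
    have := le_abs_self M
    linarith

theorem exists_height_bound {F : Set W} (hF : F.Finite) :
    ∃ a b : ℤ, ∀ v ∈ F, a < D.h v ∧ D.h v < b := by
  obtain ⟨a, ha⟩ := (hF.image D.h).bddBelow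
  obtain ⟨b, hb⟩ := (hF.image D.h).bddAbove
  refine ⟨a - 1, b + 1, fun v hv => ⟨?_, ?_⟩⟩
  · have := ha ⟨v, hv, rfl⟩
    omega
  · have := hb ⟨v, hv, rfl⟩
    omega

theorem toEnd_eq_of_tendsto_top {r s : Ray S}
    (hr : ∀ M : ℤ, ∃ N, ∀ n, N ≤ n → M < D.h (r.vertex n))
    (hs : ∀ M : ℤ, ∃ N, ∀ n, N ≤ n → M < D.h (s.vertex n)) : r.toEnd = s.toEnd := by
  refine Ray.toEnd_eq fun F hF => ?_
  obtain ⟨a, b, hab⟩ := D.exists_height_bound hF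
  have hmem : ∀ v, b < D.h v → v ∈ D.upper b := fun v hv =>
    ⟨hv.le, fun h => by have := D.h_of_mem_gate h; omega⟩
  refine ⟨D.upper b, D.connected_upper' b, fun v hv hvF => ?_, ?_, ?_⟩
  · have h1 := hv.1
    have h2 := hab v hvF
    simp only [Set.mem_ofPred_eq] at h1
    omega
  · obtain ⟨N, hN⟩ := hr b
    exact ⟨N, fun n hn => hmem _ (hN n hn)⟩
  · obtain ⟨N, hN⟩ := hs b
    exact ⟨N, fun n hn => hmem _ (hN n hn)⟩

theorem toEnd_eq_of_tendsto_bot {r s : Ray S}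
    (hr : ∀ M : ℤ, ∃ N, ∀ n, N ≤ n → D.h (r.vertex n) < M)
    (hs : ∀ M : ℤ, ∃ N, ∀ n, N ≤ n → D.h (s.vertex n) < M) : r.toEnd = s.toEnd := by
  refine Ray.toEnd_eq fun F hF => ?_
  obtain ⟨a, b, hab⟩ := D.exists_height_bound hF
  refine ⟨D.lower a, D.connected_lower a, fun v hv hvF => ?_, hr a, hs a⟩
  have h2 := hab v hvF
  simp only [lower, Set.mem_ofPred_eq] at hv
  omega

theorem posRay_top (i : Fin m) (M : ℤ) :
    ∃ N, ∀ n, N ≤ n → M < D.h ((D.posRay i).vertex n) := by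
  rcases D.ray_cases (D.posRay i) with h | h
  · exact h M
  · obtain ⟨N, hN⟩ := h 0
    have h1 : D.h (D.vertex i N) < 0 := hN N le_rfl
    rw [D.h_vertex] at h1
    have := Int.ediv_nonneg (Int.natCast_nonneg N) (D.len_pos' i).le
    omega

theorem negRay_bot (i : Fin m) (M : ℤ) :
    ∃ N, ∀ n, N ≤ n → D.h ((D.negRay i).vertex n) < M := by
  rcases D.ray_cases (D.negRay i) with h | h
  · obtain ⟨N, hN⟩ := h 0
    have h1 : 0 < D.h (D.vertex i (-N)) := hN N le_rfl
    rw [D.h_vertex] at h1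
    have := Int.ediv_le_ediv (D.len_pos' i) (show -(N : ℤ) ≤ 0 by omega)
    rw [Int.zero_ediv] at this
    omega
  · exact h M

/-- The upper end. -/
def topEnd : GraphEnd S := (D.posRay D.i₀).toEnd

/-- The lower end. -/
def botEnd : GraphEnd S := (D.negRay D.i₀).toEnd

theorem posRay_toEnd (i : Fin m) : (D.posRay i).toEnd = D.topEnd :=
  D.toEnd_eq_of_tendsto_top (D.posRay_top i) (D.posRay_top _)

theorem negRay_toEnd (i : Fin m) : (D.negRay i).toEnd = D.botEnd :=
  D.toEnd_eq_of_tendsto_bot (D.negRay_bot i) (D.negRay_bot _)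

theorem comp_topEnd (n : ℤ) : D.topEnd.comp (D.gate n) = D.upper n := by
  obtain ⟨N, hN⟩ := D.posRay_top D.i₀ n
  exact (D.posRay D.i₀).comp_eq rfl (D.finite_gate n) (D.connected_upper' n) (fun v hv => hv.2)
    (D.upper_closed n) (N := N) fun k hk =>
      ⟨(hN k hk).le, fun h => by have := D.h_of_mem_gate h; have := hN k hk; omega⟩

theorem comp_botEnd (n : ℤ) : D.botEnd.comp (D.gate n) = D.lower n := by
  obtain ⟨N, hN⟩ := D.negRay_bot D.i₀ n
  exact (D.negRay D.i₀).comp_eq rfl (D.finite_gate n) (D.connected_lower n)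
    (D.lower_notMem_gate n) (D.lower_closed n) (N := N) hN

theorem topEnd_ne_botEnd : D.topEnd ≠ D.botEnd := by
  intro h
  have h1 := D.comp_topEnd 0
  rw [h, D.comp_botEnd] at h1
  obtain ⟨v, hv⟩ := (D.connected_lower 0).1
  have h2 := hv
  rw [h1] at h2
  have h3 := h2.1
  simp only [lower, Set.mem_ofPred_eq] at hv h3
  omega

theorem eq_topEnd_or_eq_botEnd (ω : GraphEnd S) : ω = D.topEnd ∨ ω = D.botEnd := by
  obtain ⟨r, rfl⟩ := ω.exists_ray
  exact (D.ray_cases r).imp (fun h => D.toEnd_eq_of_tendsto_top h (D.posRay_top _))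
    fun h => D.toEnd_eq_of_tendsto_bot h (D.negRay_bot _)

theorem gate_nonempty (n : ℤ) : (D.gate n).Nonempty := ⟨_, D.mem_gate n D.i₀⟩

theorem isDefiningSequence_topEnd : IsDefiningSequence D.topEnd fun n : ℕ => D.gate n := by
  refine ⟨fun n => ⟨D.finite_gate n, D.gate_nonempty n⟩, fun n => ?_⟩
  simp only [D.comp_topEnd]
  have key : ∀ v, (n : ℤ) + 1 ≤ D.h v → v ∈ D.upper n := fun v hv =>
    ⟨by simp only [Set.mem_ofPred_eq]; omega, fun h => by have := D.h_of_mem_gate h; omega⟩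
  rintro v (hv | hv)
  · refine key v ?_
    have := D.h_of_mem_gate hv
    push_cast at this
    omega
  · refine key v ?_
    have := hv.1
    simp only [Set.mem_ofPred_eq] at this
    push_cast at this
    omega

theorem isDefiningSequence_botEnd : IsDefiningSequence D.botEnd fun n : ℕ => D.gate (-n) := by
  refine ⟨fun n => ⟨D.finite_gate _, D.gate_nonempty _⟩, fun n => ?_⟩
  simp only [D.comp_botEnd]
  rintro v (hv | hv)
  · have := D.h_of_mem_gate hv
    simp only [lower, Set.mem_ofPred_eq]
    push_cast at this
    omega
  · simp only [lower, Set.mem_ofPred_eq] at hv ⊢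
    push_cast at hv
    omega

/-! ### Verification of the strip axioms -/

theorem connected (D : StripData S σ m) : S.Connected := by
  refine IsConnectedSet.connected ?_
  have := (D.connected_lower 0).union (isConnectedSet_iUnion_chain
    (A := fun k : ℕ => {v | D.h v = k}) (fun k => D.connected_layer' _) fun k => by
      simpa using D.touch_layer k) (by
    obtain ⟨a, ha, b, hb, hab⟩ := D.touch_layer (-1)
    refine ⟨a, ?_, b, Set.mem_iUnion.2 ⟨0, by simpa using hb⟩, hab⟩
    simp only [lower, Set.mem_ofPred_eq] at ha ⊢
    omega)
  convert this
  symm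
  rw [Set.eq_univ_iff_forall]
  intro v
  rcases lt_or_ge (D.h v) 0 with h | h
  · exact Or.inl h
  · exact Or.inr (Set.mem_iUnion.2 ⟨(D.h v).toNat, by simp [h]⟩)

theorem isLocallyFinite (D : StripData S σ m) : IsLocallyFinite S := by
  intro v
  refine (D.finite_between (D.h v - 1) (D.h v + 1)).subset fun w hw => ?_
  have h1 := D.h_adj hw
  have h2 := D.h_adj (SimpleGraph.Adj.symm hw)
  simp only [Set.mem_ofPred_eq]
  omega

theorem actsQuasiTransitively (D : StripData S σ m) :
    ActsQuasiTransitively (⊤ : Subgroup (S ≃g S)) := by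
  refine (D.finite_layer.image fun x : W => {y : W | ∃ γ ∈ (⊤ : Subgroup (S ≃g S)), γ x = y}).subset ?_
  rintro _ ⟨x, rfl⟩
  refine ⟨(σ ^ (-D.h x)) x, (D.h_zpow _ _).trans (add_neg_cancel _), ?_⟩
  ext y
  constructor
  · rintro ⟨γ, -, rfl⟩
    exact ⟨γ * σ ^ (-D.h x), trivial, rfl⟩
  · rintro ⟨γ, -, rfl⟩
    refine ⟨γ * σ ^ (D.h x), trivial, ?_⟩
    simp only [RelIso.mul_apply]
    rw [zpow_zpow_neg]

/-- The gates realise `m`, and the `m` disjoint ascending rays exclude anything smaller. -/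
theorem isThinOfSize_topEnd : D.topEnd.IsThinOfSize m := by
  refine ⟨⟨_, D.isDefiningSequence_topEnd, fun n => D.ncard_gate n⟩, ?_⟩
  rintro k ⟨L, hL, hk⟩
  obtain ⟨n, hn⟩ := hL.exists_le_ncard D.connected D.posRay D.posRay_toEnd
    fun i j k l h => (D.vertex_inj h).1
  rwa [hk] at hn

theorem isThinOfSize_botEnd : D.botEnd.IsThinOfSize m := by
  refine ⟨⟨_, D.isDefiningSequence_botEnd, fun n => D.ncard_gate _⟩, ?_⟩
  rintro k ⟨L, hL, hk⟩
  obtain ⟨n, hn⟩ := hL.exists_le_ncard D.connected D.negRay D.negRay_toEnd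
    fun i j k l h => (D.vertex_inj h).1
  rwa [hk] at hn

theorem segment_eq : (D.gate 0 ∪ D.upper 0) \ D.upper 1 = {v | D.h v = 0} ∪ D.gate 1 := by
  ext v
  simp only [upper, Set.mem_sdiff, Set.mem_union, Set.mem_ofPred_eq, not_and, not_not]
  constructor
  · rintro ⟨h1, h2⟩
    by_cases h3 : 1 ≤ D.h v
    · exact Or.inr (h2 h3)
    · left
      rcases h1 with h1 | h1
      · exact D.h_of_mem_gate h1
      · omega
  · rintro (h | h)
    · refine ⟨?_, fun h' => by omega⟩
      by_cases h3 : v ∈ D.gate 0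
      · exact Or.inl h3
      · exact Or.inr ⟨by omega, h3⟩
    · have h1 := D.h_of_mem_gate h
      exact ⟨Or.inr ⟨by omega, fun h2 => by have := D.h_of_mem_gate h2; omega⟩, fun _ => h⟩

theorem isStripOfSize (D : StripData S σ m) : IsStripOfSize S σ m := by
  have hpow : ∀ n : ℕ, (σ ^ n) '' Set.range D.e = D.gate n := fun n => by
    rw [gate, zpow_natCast]
  have hpow' : ∀ n : ℕ, (σ⁻¹ ^ n) '' Set.range D.e = D.gate (-n) := fun n => by
    rw [gate, zpow_neg, zpow_natCast, inv_pow]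
  have hgate1 : σ '' Set.range D.e = D.gate 1 := by rw [gate, zpow_one]
  refine ⟨D.connected, D.isLocallyFinite, D.actsQuasiTransitively, D.topEnd, D.botEnd,
    D.topEnd_ne_botEnd, D.eq_topEnd_or_eq_botEnd, D.isThinOfSize_topEnd, D.isThinOfSize_botEnd,
    Set.range D.e, Set.finite_range _, ?_, ?_, ?_, ⟨D.doubleRay, ?_, D.map_doubleRay, ?_⟩, ?_⟩
  · rw [← D.gate_zero]
    exact D.ncard_gate 0
  · simpa only [hpow] using D.isDefiningSequence_topEnd
  · simpa only [hpow'] using D.isDefiningSequence_botEnd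
  · intro i j hij
    rw [Set.disjoint_left]
    rintro _ ⟨a, rfl⟩ ⟨b, hb⟩
    exact hij (D.vertex_inj hb).1.symm
  · intro i n
    refine ⟨(σ ^ n) (D.e i), ⟨⟨n * D.len i, D.vertex_mul_len i n⟩, D.mem_gate n i⟩, ?_⟩
    rintro _ ⟨⟨k, rfl⟩, hk⟩
    exact D.vertex_mem_gate hk
  · rw [hgate1, ← D.gate_zero, D.comp_topEnd, D.comp_topEnd, D.segment_eq]
    refine ⟨D.finite_layer.union (D.finite_gate 1), IsConnectedSet.induce_connected ?_⟩
    have h1 : D.gate 1 = ⋃ i, {(σ ^ (1 : ℤ)) (D.e i)} := by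
      ext v
      simp [gate, eq_comm]
    rw [h1]
    refine D.connected_layer.union_iUnion (fun i => isConnectedSet_singleton _) fun i => ?_
    obtain ⟨a, ha, hab⟩ := D.exists_adj_gate 0 i
    exact ⟨a, ha, _, rfl, Or.inr (by simpa using hab)⟩

end StripData

/-! ### Families of finite sets and their hitting sets -/

/-- If no set of at most `k` elements hits every member of a family of finite sets, then the same
is true for a finite subfamily. -/
theorem exists_finite_subfamily {V : Type*} [DecidableEq V] (k : ℕ) :
    ∀ P : Set (Finset V), (∀ L : Finset V, L.card ≤ k → ∃ Q ∈ P, Disjoint Q L) →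
      ∃ R ⊆ P, R.Finite ∧ ∀ L : Finset V, L.card ≤ k → ∃ Q ∈ R, Disjoint Q L := by
  induction k with
  | zero =>
    intro P h
    obtain ⟨Q, hQ, -⟩ := h ∅ le_rfl
    refine ⟨{Q}, by simpa using hQ, Set.finite_singleton _, fun L hL => ⟨Q, rfl, ?_⟩⟩
    rw [Finset.card_eq_zero.1 (Nat.le_zero.1 hL)]
    exact Finset.disjoint_empty_right _
  | succ k ih =>
    intro P h
    obtain ⟨Q, hQ, -⟩ := h ∅ (Nat.zero_le _)
    -- A set of at most `k + 1` elements that hits `Q` contains some `z ∈ Q`, and its other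
    -- elements, at most `k`, are left to deal with the members avoiding `z`. The induction
    -- hypothesis is applied to these members for each of the finitely many `z ∈ Q`.
    have hz : ∀ z, ∀ L : Finset V, L.card ≤ k → ∃ Q' ∈ {Q' ∈ P | z ∉ Q'}, Disjoint Q' L := by
      intro z L hL
      obtain ⟨Q', hQ', hd⟩ := h (insert z L) ((Finset.card_insert_le _ _).trans (by omega))
      rw [Finset.disjoint_insert_right] at hd
      exact ⟨Q', ⟨hQ', hd.1⟩, hd.2⟩
    choose R hR1 hR2 hR3 using fun z => ih _ (hz z)
    refine ⟨{Q} ∪ ⋃ z ∈ Q, R z, ?_, (Set.finite_singleton _).union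
      (Q.finite_toSet.biUnion fun z _ => hR2 z), ?_⟩
    · refine Set.union_subset (by simpa using hQ) (Set.iUnion₂_subset fun z _ => ?_)
      exact (hR1 z).trans fun _ h => h.1
    · intro L hL
      by_cases hd : Disjoint Q L
      · exact ⟨Q, Or.inl rfl, hd⟩
      · obtain ⟨z, hzQ, hzL⟩ := Finset.not_disjoint_iff.1 hd
        obtain ⟨Q', hQ', hd'⟩ := hR3 z (L.erase z) (by rw [Finset.card_erase_of_mem hzL]; omega)
        refine ⟨Q', Or.inr (Set.mem_biUnion hzQ hQ'), ?_⟩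
        rw [← Finset.insert_erase hzL, Finset.disjoint_insert_right]
        exact ⟨(hR1 z hQ').2, hd'⟩

/-- `L` hits every member of the family `P`, and no proper subset of `L` does. -/
def IsMinimalHittingSet {V : Type*} [DecidableEq V] (P : Set (Finset V)) (L : Finset V) : Prop :=
  (∀ Q ∈ P, ¬ Disjoint Q L) ∧ ∀ z ∈ L, ∃ Q ∈ P, Disjoint Q (L.erase z)

/-- Fix a member `Q`. A hitting set contains one of the finitely many `z ∈ Q`, and without `z` it is
a minimal hitting set of the members avoiding `z`. For the empty family only the empty set is
minimal. -/
theorem finite_minimalHittingSet {V : Type*} [DecidableEq V] (k : ℕ) :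
    ∀ P : Set (Finset V), {L : Finset V | L.card = k ∧ IsMinimalHittingSet P L}.Finite := by
  induction k with
  | zero =>
    intro P
    exact (Set.finite_singleton ∅).subset fun L hL => Finset.card_eq_zero.1 hL.1
  | succ k ih =>
    intro P
    rcases P.eq_empty_or_nonempty with rfl | ⟨Q, hQ⟩
    · refine Set.finite_empty.subset fun L hL => ?_
      obtain ⟨z, hz⟩ : L.Nonempty := Finset.card_pos.1 (by rw [hL.1]; omega)
      obtain ⟨Q, hQ, -⟩ := hL.2.2 z hz
      exact hQ
    · refine (Q.finite_toSet.biUnion fun z _ =>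
        (ih {Q' ∈ P | z ∉ Q'}).image (insert z)).subset ?_
      rintro L ⟨hcard, hhit, hmin⟩
      obtain ⟨z, hzQ, hzL⟩ := Finset.not_disjoint_iff.1 (hhit Q hQ)
      refine Set.mem_biUnion hzQ ⟨L.erase z, ⟨?_, ?_, ?_⟩, Finset.insert_erase hzL⟩
      · rw [Finset.card_erase_of_mem hzL, hcard, Nat.add_sub_cancel]
      · rintro Q' ⟨hQ', hz⟩ hd
        apply hhit Q' hQ'
        rw [← Finset.insert_erase hzL, Finset.disjoint_insert_right]
        exact ⟨hz, hd⟩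
      · intro w hw
        rw [Finset.mem_erase] at hw
        obtain ⟨Q', hQ', hd⟩ := hmin w hw.2
        refine ⟨Q', ⟨hQ', fun hz => ?_⟩, ?_⟩
        · exact Finset.disjoint_left.1 hd hz (Finset.mem_erase.2 ⟨hw.1.symm, hzL⟩)
        · exact hd.mono_right (Finset.erase_subset_erase _ (Finset.erase_subset _ _))

/-! ### A form of Menger's theorem -/

/-- A form of Menger's theorem: if fewer than `|A|` vertices never separate `A` from `B` inside
`U`, then there is a finite set `F` in `U` and an injection moving `F \ B` along edges to `F \ A`.
Its orbits that start in `A` are disjoint paths from `A` to `B`. -/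
theorem exists_linkage [DecidableEq V] {U : Set V} {A B : Finset V} (hAU : (A : Set V) ⊆ U)
    (hBU : (B : Set V) ⊆ U) (hA : A.Nonempty)
    (hsep : ∀ L : Finset V, L.card < A.card → ∃ Q : Finset V, (Q : Set V) ⊆ U ∧
      IsConnectedSet G (Q : Set V) ∧ Disjoint Q L ∧ (∃ a ∈ A, a ∈ Q) ∧ ∃ b ∈ B, b ∈ Q) :
    ∃ F : Finset V, A ⊆ F ∧ B ⊆ F ∧ (F : Set V) ⊆ U ∧ ∃ f : V → V,
      (∀ v ∈ F, v ∉ B → f v ∈ F ∧ f v ∉ A ∧ (f v = v ∨ G.Adj v (f v))) ∧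
      ∀ v ∈ F, v ∉ B → ∀ w ∈ F, w ∉ B → f v = f w → v = w := by
  classical
  have hpos := Finset.card_pos.2 hA
  obtain ⟨R, hRP, hRfin, hR⟩ := exists_finite_subfamily (A.card - 1)
    {Q : Finset V | (Q : Set V) ⊆ U ∧ IsConnectedSet G (Q : Set V) ∧ (∃ a ∈ A, a ∈ Q) ∧
      ∃ b ∈ B, b ∈ Q} (fun L hL => by
      obtain ⟨Q, h1, h2, h3, h4, h5⟩ := hsep L (by omega)
      exact ⟨Q, ⟨h1, h2, h4, h5⟩, h3⟩)
  set F : Finset V := A ∪ B ∪ hRfin.toFinset.biUnion id with hF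
  have hRF : ∀ Q ∈ R, Q ⊆ F := fun Q hQ =>
    (Finset.subset_biUnion_of_mem id (hRfin.mem_toFinset.2 hQ)).trans Finset.subset_union_right
  have hAF : A ⊆ F := Finset.subset_union_left.trans Finset.subset_union_left
  have hBF : B ⊆ F := Finset.subset_union_right.trans Finset.subset_union_left
  have hFU : (F : Set V) ⊆ U := by
    intro v hv
    rw [hF] at hv
    simp only [Finset.coe_union, Finset.coe_biUnion, Set.mem_union, Set.mem_iUnion, id] at hv
    rcases hv with (hv | hv) | ⟨Q, hQ, hv⟩
    · exact hAU hv
    · exact hBU hv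
    · exact (hRP (hRfin.mem_toFinset.1 hQ)).1 hv
  refine ⟨F, hAF, hBF, hFU, ?_⟩
  -- Hall's theorem supplies the injection. A vertex outside `A` may be matched with itself, which
  -- takes care of vertices on no path.
  have hall := (Finset.all_card_le_biUnion_card_iff_exists_injective
    (fun v : {v // v ∈ F \ B} => (F \ A).filter fun u : V => u = v.1 ∨ G.Adj v.1 u)).1 (by
    intro s
    by_contra! hlt
    set T : Finset V := s.map (Function.Embedding.subtype _) with hT
    have hTF : ∀ v ∈ T, v ∈ F ∧ v ∉ B := by
      intro v hv
      obtain ⟨w, -, rfl⟩ := Finset.mem_map.1 hv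
      exact Finset.mem_sdiff.1 w.2
    set N : Finset V := F.filter fun u => ∃ t ∈ T, u = t ∨ G.Adj t u with hN
    have hTN : T ⊆ N := fun v hv => Finset.mem_filter.2 ⟨(hTF v hv).1, v, hv, Or.inl rfl⟩
    have hsub : N \ A ⊆ s.biUnion
        fun v : {v // v ∈ F \ B} => (F \ A).filter fun u : V => u = v.1 ∨ G.Adj v.1 u := by
      intro u hu
      obtain ⟨hu1, hu2⟩ := Finset.mem_sdiff.1 hu
      obtain ⟨hu3, t, ht, htu⟩ := Finset.mem_filter.1 hu1
      obtain ⟨w, hw, rfl⟩ := Finset.mem_map.1 ht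
      exact Finset.mem_biUnion.2 ⟨w, hw, Finset.mem_filter.2
        ⟨Finset.mem_sdiff.2 ⟨hu3, hu2⟩, htu⟩⟩
    have hc1 := (Finset.card_le_card hsub).trans_lt hlt
    have hc2 : s.card = T.card := by rw [hT, Finset.card_map]
    have hc3 : (N \ A).card + (N ∩ A).card = N.card := Finset.card_sdiff_add_card_inter N A
    have hc4 : (A \ N).card + (A ∩ N).card = A.card := Finset.card_sdiff_add_card_inter A N
    have hc5 : (N \ T).card + T.card = N.card := Finset.card_sdiff_add_card_eq_card hTN
    rw [Finset.inter_comm] at hc4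
    have hc6 := Finset.card_union_le (N \ T) (A \ N)
    -- If Hall's condition fails for `T`, then `|N \ T| + |A \ N| = |A| + |N \ A| - |T| < |A|`, so
    -- some `Q` in `R` avoids this set. Its vertex in `A` lies in `T`, and a step out of `T` would
    -- land in `N \ T`; thus `Q` stays in `T`, which misses `B`.
    obtain ⟨Q, hQR, hQL⟩ := hR (N \ T ∪ A \ N) (by omega)
    obtain ⟨-, hQc, ⟨a, haA, haQ⟩, b, hbB, hbQ⟩ := hRP hQR
    have hnot : ∀ v ∈ Q, v ∉ N \ T ∪ A \ N := fun v hv => Finset.disjoint_left.1 hQL hv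
    have haT : a ∈ T := by
      have := hnot a haQ
      simp only [Finset.mem_union, Finset.mem_sdiff] at this
      tauto
    have hQT : (Q : Set V) ⊆ T := by
      refine hQc.2 T ⟨a, haQ, haT⟩ fun v hv hvT w hw hvw => ?_
      have hwN : w ∈ N := Finset.mem_filter.2 ⟨hRF Q hQR hw, v, hvT, Or.inr hvw⟩
      have := hnot w hw
      simp only [Finset.mem_union, Finset.mem_sdiff] at this
      simp only [Finset.mem_coe]
      tauto
    exact (hTF b (hQT hbQ)).2 hbB)
  obtain ⟨f, hfinj, hf⟩ := hall
  refine ⟨fun v => if h : v ∈ F \ B then f ⟨v, h⟩ else v, ?_, ?_⟩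
  · intro v hv hvB
    have hv' : v ∈ F \ B := Finset.mem_sdiff.2 ⟨hv, hvB⟩
    have := hf ⟨v, hv'⟩
    simp only [Finset.mem_filter, Finset.mem_sdiff] at this
    simp only [dif_pos hv']
    tauto
  · intro v hv hvB w hw hwB hvw
    have hv' : v ∈ F \ B := Finset.mem_sdiff.2 ⟨hv, hvB⟩
    have hw' : w ∈ F \ B := Finset.mem_sdiff.2 ⟨hw, hwB⟩
    simp only [dif_pos hv', dif_pos hw'] at hvw
    exact congrArg Subtype.val (hfinj hvw)

/-! ### Disjoint rays of a thin end -/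

variable {ω : GraphEnd G}

theorem comp_subset_comp {K L : Set V} (hK : K.Finite) (hL : L.Finite)
    (h : ∀ v ∈ ω.comp K, v ∉ L) : ω.comp K ⊆ ω.comp L := by
  obtain ⟨r, hr⟩ := ω.exists_ray
  obtain ⟨N, hN⟩ := r.eventually_mem_comp hr hK
  obtain ⟨M, hM⟩ := r.eventually_mem_comp hr hL
  exact (ω.isConnectedSet_comp hK).subset_comp h (hN _ (le_max_left N M)) (hM _ (le_max_right N M))

/-- For a thin end of size `m`, fewer than `m` vertices do not separate late members of a
defining sequence from the end. -/
theorem eventually_not_separated (hG : G.Connected) {m : ℕ} (hω : ω.IsThinOfSize m)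
    {K : ℕ → Set V} (hK : IsDefiningSequence ω K) :
    ∃ N, ∀ n, N ≤ n → ∀ L : Finset V, (L : Set V) ⊆ K n ∪ ω.comp (K n) → L.card < m →
      ∃ a ∈ K n, a ∈ ω.comp (L : Set V) := by
  classical
  by_contra! hcon
  -- There are only finitely many sizes below `m`, so a single size `k` recurs arbitrarily late.
  have hk : ∃ k < m, ∀ N, ∃ n, N ≤ n ∧ ∃ L : Finset V, (L : Set V) ⊆ K n ∪ ω.comp (K n) ∧
      L.card = k ∧ ∀ a ∈ K n, a ∉ ω.comp (L : Set V) := by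
    by_contra! hcon'
    choose! N hN using hcon'
    obtain ⟨n, hn, L, h1, h2, h3⟩ := hcon ((Finset.range m).sup N)
    obtain ⟨a, ha, ha'⟩ := hN L.card h2 n
      ((Finset.le_sup (f := N) (Finset.mem_range.2 h2)).trans hn) L h1 rfl
    exact h3 a ha ha'
  obtain ⟨k, hkm, hk⟩ := hk
  let T := {L : Finset V // L.card = k ∧ L.Nonempty}
  -- Take a separator `L'` of a `K (n + 1)` for which `K n` is already beyond `L`. Then `C(L', ω) ⊆
  -- C(K (n + 1), ω)`, and `L'` and this component lie in `C(K n, ω) ⊆ C(L, ω)`. Iteration gives a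
  -- defining sequence with members of size `k < m`.
  have hnext : ∀ L : T, ∃ L' : T,
      ((L'.1 : Set V) ∪ ω.comp (L'.1 : Set V)) ⊆ ω.comp (L.1 : Set V) := by
    intro L
    obtain ⟨N, hN⟩ := hK.eventually_disjoint hG L.1.finite_toSet
    obtain ⟨n, hn, L', h1, h2, h3⟩ := hk (N + 1)
    obtain ⟨n, rfl⟩ : ∃ n', n = n' + 1 := ⟨n - 1, by omega⟩
    have h4 : ω.comp (L' : Set V) ⊆ ω.comp (K (n + 1)) :=
      comp_subset_comp L'.finite_toSet (hK.1 _).1 fun v hv hv' => h3 v hv' hv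
    have h5 : ω.comp (K n) ⊆ ω.comp (L.1 : Set V) :=
      comp_subset_comp (hK.1 _).1 L.1.finite_toSet fun v hv hv' =>
        hN n (by omega) v hv' (Or.inr hv)
    -- The empty set separates nothing in a connected graph.
    have hne : L'.Nonempty := by
      rw [Finset.nonempty_iff_ne_empty]
      rintro rfl
      obtain ⟨a, ha⟩ := (hK.1 (n + 1)).2
      obtain ⟨x, hx⟩ := (ω.isConnectedSet_comp (K := ((∅ : Finset V) : Set V)) (by simp)).1
      exact h3 a ha ((isConnectedSet_univ hG).subset_comp (by simp) (Set.mem_univ x) hx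
        (Set.mem_univ a))
    refine ⟨⟨L', h2, hne⟩, Set.Subset.trans ?_ ((hK.2 n).trans h5)⟩
    exact Set.union_subset h1 (h4.trans Set.subset_union_right)
  choose next hnext' using hnext
  have hk0 : Nonempty T := by
    by_contra hemp
    rw [not_nonempty_iff] at hemp
    obtain ⟨n, -, L, h1, h2, h3⟩ := hk 0
    rcases L.eq_empty_or_nonempty with rfl | hL
    · obtain ⟨a, ha⟩ := (hK.1 n).2
      obtain ⟨x, hx⟩ := (ω.isConnectedSet_comp (K := ((∅ : Finset V) : Set V)) (by simp)).1
      exact h3 a ha ((isConnectedSet_univ hG).subset_comp (by simp) (Set.mem_univ x) hx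
        (Set.mem_univ a))
    · exact hemp.false ⟨L, h2, hL⟩
  obtain ⟨L₀⟩ := hk0
  have hmem : k ∈ {k : ℕ | ∃ K : ℕ → Set V, IsDefiningSequence ω K ∧ ∀ n, (K n).ncard = k} := by
    refine ⟨fun n => ((next^[n] L₀).1 : Set V), ⟨fun n => ⟨Finset.finite_toSet _, ?_⟩, fun n => ?_⟩,
      fun n => ?_⟩
    · exact (next^[n] L₀).2.2
    · beta_reduce
      rw [Function.iterate_succ_apply']
      exact hnext' _
    · rw [Set.ncard_coe_finset]
      exact (next^[n] L₀).2.1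
  exact absurd (hω.2 hmem) (by omega)

/-- If fewer than `m` vertices do not separate `K n` from the end, then they do not separate it
from `K (n + 1)` in the part between the two. -/
theorem IsDefiningSequence.exists_connected_between {K : ℕ → Set V}
    (hK : IsDefiningSequence ω K) {m n : ℕ}
    (hn : ∀ L : Finset V, (L : Set V) ⊆ K n ∪ ω.comp (K n) → L.card < m →
      ∃ a ∈ K n, a ∈ ω.comp (L : Set V)) (L : Finset V) (hL : L.card < m) :
    ∃ Q : Finset V, (Q : Set V) ⊆ (K n ∪ ω.comp (K n)) \ ω.comp (K (n + 1)) ∧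
      IsConnectedSet G (Q : Set V) ∧ Disjoint Q L ∧ (∃ a ∈ K n, a ∈ Q) ∧
      ∃ b ∈ K (n + 1), b ∈ Q := by
  classical
  set L' := L.filter (· ∈ K n ∪ ω.comp (K n)) with hL'
  obtain ⟨a, haK, haL⟩ := hn L' (by intro v hv; simp [hL'] at hv; exact hv.2)
    ((Finset.card_filter_le _ _).trans_lt hL)
  have hsucc : ω.comp (K (n + 1)) ⊆ ω.comp (K n) := Set.subset_union_right.trans (hK.2 n)
  have hnotL : ∀ v, v ∈ ω.comp (L' : Set V) → v ∈ K n ∪ ω.comp (K n) → v ∉ L := by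
    intro v hv hv' hvL
    exact GraphEnd.notMem_of_mem_comp hv (by simp [hL', hvL]; exact hv')
  by_contra! hcon
  -- The vertices reached from `K n` inside the segment while avoiding `L`; by assumption `T` misses
  -- `K (n + 1)`.
  let T : Set V := {v | ∃ Q : Finset V,
    (Q : Set V) ⊆ (K n ∪ ω.comp (K n)) \ ω.comp (K (n + 1)) ∧
      IsConnectedSet G (Q : Set V) ∧ Disjoint Q L ∧ (∃ a ∈ K n, a ∈ Q) ∧ v ∈ Q}
  have hKT : ∀ v ∈ K n, v ∈ ω.comp (L' : Set V) → v ∈ T := by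
    intro v hv hvL
    refine ⟨{v}, ?_, by simpa using isConnectedSet_singleton v, ?_, ⟨v, hv, by simp⟩, by simp⟩
    · rw [Finset.coe_singleton, Set.singleton_subset_iff]
      exact ⟨Or.inl hv, fun h => GraphEnd.notMem_of_mem_comp (hsucc h) hv⟩
    · rw [Finset.disjoint_singleton_left]
      exact hnotL v hvL (Or.inl hv)
  -- A walk avoiding `L'` may leave `K n ∪ C(K n, ω)`, but it re-enters through `K n`, hence in `T`.
  -- A ray of `ω` finally contradicts the inclusion, since it ends up in `C(K (n + 1), ω)`.
  have hsub : ω.comp (L' : Set V) ⊆ T ∪ (K n ∪ ω.comp (K n))ᶜ := by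
    refine (ω.isConnectedSet_comp L'.finite_toSet).2 _ ⟨a, haL, Or.inl (hKT a haK haL)⟩ ?_
    intro u hu huY w hw huw
    by_cases hwD : w ∈ K n ∪ ω.comp (K n)
    swap
    · exact Or.inr hwD
    left
    rcases huY with ⟨Q, h1, h2, h3, h4, h5⟩ | huD
    · have hwC : w ∉ ω.comp (K (n + 1)) := by
        intro hwC
        by_cases huK : u ∈ K (n + 1)
        · exact hcon Q h1 h2 h3 h4 u huK h5
        · exact (h1 h5).2 (GraphEnd.mem_comp_of_adj hwC huK huw.symm)
      refine ⟨Q ∪ {w}, ?_, ?_, ?_, ?_, by simp⟩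
      · rw [Finset.coe_union, Finset.coe_singleton]
        exact Set.union_subset h1 (Set.singleton_subset_iff.2 ⟨hwD, hwC⟩)
      · rw [Finset.coe_union, Finset.coe_singleton]
        exact h2.union (isConnectedSet_singleton w) ⟨u, h5, w, rfl, Or.inr huw⟩
      · rw [Finset.disjoint_union_left, Finset.disjoint_singleton_left]
        exact ⟨h3, hnotL w hw hwD⟩
      · obtain ⟨x, hx, hxQ⟩ := h4
        exact ⟨x, hx, Finset.mem_union_left _ hxQ⟩
    · refine hKT w ?_ hw
      by_contra hwK
      have hwC : w ∈ ω.comp (K n) := hwD.resolve_left hwK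
      by_cases huK : u ∈ K n
      · exact huD (Or.inl huK)
      · exact huD (Or.inr (GraphEnd.mem_comp_of_adj hwC huK huw.symm))
  obtain ⟨r, hr⟩ := ω.exists_ray
  obtain ⟨N, hN⟩ := r.eventually_mem_comp hr L'.finite_toSet
  obtain ⟨M, hM⟩ := r.eventually_mem_comp hr (hK.1 (n + 1)).1
  have h1 := hM _ (le_max_right N M)
  rcases hsub (hN _ (le_max_left N M)) with ⟨Q, h2, -, -, -, h3⟩ | h2
  · exact (h2 h3).2 h1
  · exact h2 (Or.inr (hsucc h1))

/-- Disjoint rays `r i`, the `i`-th of which enters `K n ∪ C(K n, ω)` at time `t n i`, through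
`K n`, and stays there. -/
structure RaySystem (ω : GraphEnd G) (K : ℕ → Set V) (m : ℕ) where
  r : Fin m → ℕ → V
  t : ℕ → Fin m → ℕ
  inj : ∀ i j k l, r i k = r j l → i = j ∧ k = l
  adj : ∀ i k, G.Adj (r i k) (r i (k + 1))
  mem : ∀ n i, r i (t n i) ∈ K n
  mem_iff : ∀ n i s, r i s ∈ K n ∪ ω.comp (K n) ↔ t n i ≤ s

/-- The linkages from `K n` to `K (n + 1)` are glued to a single injective map `g`. The rays are the
`g`-orbits of the vertices of `K 0`. -/
theorem IsDefiningSequence.nonempty_raySystem {K : ℕ → Set V} (hK : IsDefiningSequence ω K)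
    {m : ℕ} (hm : ∀ n, (K n).ncard = m)
    (hsep : ∀ n, ∀ L : Finset V, (L : Set V) ⊆ K n ∪ ω.comp (K n) → L.card < m →
      ∃ a ∈ K n, a ∈ ω.comp (L : Set V)) : Nonempty (RaySystem ω K m) := by
  classical
  have hlink : ∀ n, ∃ F : Finset V, K n ⊆ F ∧ K (n + 1) ⊆ F ∧
      (F : Set V) ⊆ (K n ∪ ω.comp (K n)) \ ω.comp (K (n + 1)) ∧ ∃ f : V → V,
      (∀ v ∈ F, v ∉ K (n + 1) → f v ∈ F ∧ f v ∉ K n ∧ (f v = v ∨ G.Adj v (f v))) ∧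
      ∀ v ∈ F, v ∉ K (n + 1) → ∀ w ∈ F, w ∉ K (n + 1) → f v = f w → v = w := by
    intro n
    have hsucc : ω.comp (K (n + 1)) ⊆ ω.comp (K n) := Set.subset_union_right.trans (hK.2 n)
    obtain ⟨F, h1, h2, h3, f, h4, h5⟩ := exists_linkage (G := G)
      (U := (K n ∪ ω.comp (K n)) \ ω.comp (K (n + 1)))
      (A := (hK.1 n).1.toFinset) (B := (hK.1 (n + 1)).1.toFinset)
      (by
        rw [Set.Finite.coe_toFinset]
        exact fun v hv => ⟨Or.inl hv, fun h => GraphEnd.notMem_of_mem_comp (hsucc h) hv⟩)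
      (by
        rw [Set.Finite.coe_toFinset]
        exact fun v hv => ⟨Or.inr (hK.2 n (Or.inl hv)), fun h =>
          GraphEnd.notMem_of_mem_comp h hv⟩)
      (by simpa using (hK.1 n).2)
      (by
        intro L hL
        rw [← Set.ncard_eq_toFinset_card _ (hK.1 n).1, hm] at hL
        simpa using hK.exists_connected_between (hsep n) L hL)
    simp only [Set.Finite.mem_toFinset, Set.Finite.toFinset_subset] at h1 h2 h4 h5
    exact ⟨F, h1, h2, h3, f, h4, h5⟩
  choose F hF1 hF2 hF3 f hf hfinj using hlink
  have hlevel : ∀ n k v, v ∈ F n → v ∉ K (n + 1) → v ∈ K k ∪ ω.comp (K k) → k ≤ n := by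
    intro n k v hv hvK hvD
    by_contra! hlt
    rcases hK.antitone hlt hvD with h | h
    · exact hvK h
    · exact (hF3 n hv).2 h
  have huniq : ∀ n k v, v ∈ F n → v ∉ K (n + 1) → v ∈ F k → v ∉ K (k + 1) → n = k :=
    fun n k v h1 h2 h3 h4 => le_antisymm (hlevel k n v h3 h4 (hF3 n h1).1)
      (hlevel n k v h1 h2 (hF3 k h3).1)
  let U : Set V := {v | ∃ n, v ∈ F n ∧ v ∉ K (n + 1)}
  have hFU : ∀ n, ∀ v ∈ F n, v ∈ U := by
    intro n v hv
    by_cases hvK : v ∈ K (n + 1)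
    · exact ⟨n + 1, hF1 _ hvK, fun h =>
        GraphEnd.notMem_of_mem_comp (hK.2 (n + 1) (Or.inl h)) hvK⟩
    · exact ⟨n, hv, hvK⟩
  -- By `huniq` the index is unique, so the choice is immaterial.
  let g : V → V := fun v => if h : ∃ n, v ∈ F n ∧ v ∉ K (n + 1) then f h.choose v else v
  have hg : ∀ n v, v ∈ F n → v ∉ K (n + 1) → g v = f n v := by
    intro n v h1 h2
    have h : ∃ n, v ∈ F n ∧ v ∉ K (n + 1) := ⟨n, h1, h2⟩
    have : g v = f h.choose v := dif_pos h
    rw [this, huniq _ _ v h.choose_spec.1 h.choose_spec.2 h1 h2]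
  have hgU : ∀ v ∈ U, g v ∈ U ∧ g v ∉ K 0 ∧ (g v = v ∨ G.Adj v (g v)) := by
    rintro v ⟨n, h1, h2⟩
    rw [hg n v h1 h2]
    obtain ⟨h3, h4, h5⟩ := hf n v h1 h2
    refine ⟨hFU n _ h3, fun h0 => ?_, h5⟩
    rcases Nat.eq_zero_or_pos n with rfl | hn
    · exact h4 h0
    · exact GraphEnd.notMem_of_mem_comp (hK.union_subset_comp hn (hF3 n h3).1) h0
  have hgD : ∀ n, ∀ v ∈ U, v ∈ K n ∪ ω.comp (K n) → g v ∈ K n ∪ ω.comp (K n) := by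
    rintro n v ⟨k, h1, h2⟩ hv
    rw [hg k v h1 h2]
    exact hK.antitone (hlevel k n v h1 h2 hv) (hF3 k (hf k v h1 h2).1).1
  -- Images from different levels differ: `f n v` lies outside `C(K (n + 1), ω)`, whereas `f k w`,
  -- not being in `K k`, lies in `C(K k, ω)`, which is contained in it.
  have hne : ∀ n k v w, v ∈ F n → v ∉ K (n + 1) → w ∈ F k → w ∉ K (k + 1) → n < k →
      g v ≠ g w := by
    intro n k v w h1 h2 h3 h4 hnk heq
    rw [hg n v h1 h2, hg k w h3 h4] at heq
    have h5 := hf n v h1 h2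
    have h6 := hf k w h3 h4
    rw [← heq] at h6
    have h7 := (hK.antitone (n := n + 1) hnk).trans' Set.subset_union_right
      ((hF3 k h6.1).1.resolve_left h6.2.1)
    rcases h7 with h7 | h7
    · have h8 := (hF3 k h6.1).1.resolve_left h6.2.1
      rcases Nat.eq_or_lt_of_le hnk with h9 | h9
      · rw [← h9] at h8
        exact GraphEnd.notMem_of_mem_comp h8 h7
      · exact GraphEnd.notMem_of_mem_comp (hK.union_subset_comp h9 (Or.inr h8)) h7
    · exact (hF3 n h5.1).2 h7
  have hginj : ∀ v ∈ U, ∀ w ∈ U, g v = g w → v = w := by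
    rintro v ⟨n, h1, h2⟩ w ⟨k, h3, h4⟩ heq
    rcases lt_trichotomy n k with hlt | rfl | hlt
    · exact absurd heq (hne n k v w h1 h2 h3 h4 hlt)
    · rw [hg n v h1 h2, hg n w h3 h4] at heq
      exact hfinj n v h1 h2 w h3 h4 heq
    · exact absurd heq.symm (hne k n w v h3 h4 h1 h2 hlt)
  have hK0 : ∀ v ∈ K 0, v ∈ U := fun v hv => hFU 0 v (hF1 0 hv)
  have hitU : ∀ v ∈ K 0, ∀ s, g^[s] v ∈ U := by
    intro v hv s
    induction s with
    | zero => exact hK0 v hv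
    | succ s ih =>
      rw [Function.iterate_succ_apply']
      exact (hgU _ ih).1
  -- As `g` is injective and takes no value in `K 0`, distinct starting vertices have disjoint
  -- orbits and no orbit repeats a vertex.
  have hitinj : ∀ v ∈ K 0, ∀ w ∈ K 0, ∀ s k, g^[s] v = g^[k] w → v = w ∧ s = k := by
    intro v hv w hw s
    induction s with
    | zero =>
      intro k h
      cases k with
      | zero => exact ⟨h, rfl⟩
      | succ k =>
        rw [Function.iterate_succ_apply'] at h
        exact absurd (h ▸ hv : g (g^[k] w) ∈ K 0) (hgU _ (hitU w hw k)).2.1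
    | succ s ih =>
      intro k h
      rw [Function.iterate_succ_apply'] at h
      cases k with
      | zero => exact absurd (h ▸ hw : g (g^[s] v) ∈ K 0) (hgU _ (hitU v hv s)).2.1
      | succ k =>
        rw [Function.iterate_succ_apply'] at h
        obtain ⟨h1, h2⟩ := ih k (hginj _ (hitU v hv s) _ (hitU w hw k) h)
        exact ⟨h1, by rw [h2]⟩
  have hreach : ∀ v ∈ K 0, ∀ n, ∃ s, g^[s] v ∈ K n := by
    intro v hv n
    induction n with
    | zero => exact ⟨0, hv⟩
    | succ n ih =>
      obtain ⟨s, hs⟩ := ih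
      by_contra! hcon
      -- An orbit that misses `K (n + 1)` would stay in the finite set `F n` without repetition.
      have hall : ∀ j, g^[s + j] v ∈ F n := by
        intro j
        induction j with
        | zero => exact hF1 n hs
        | succ j ihj =>
          rw [← add_assoc, Function.iterate_succ_apply', hg n _ ihj (hcon _)]
          exact (hf n _ ihj (hcon _)).1
      exact Set.infinite_of_injective_forall_mem (f := fun j => g^[s + j] v)
        (fun j k h => by have := (hitinj v hv v hv _ _ h).2; omega) hall (F n).finite_toSet
  have hfirst : ∀ v ∈ K 0, ∀ n, ∃ s, g^[s] v ∈ K n ∧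
      ∀ k, g^[k] v ∈ K n ∪ ω.comp (K n) ↔ s ≤ k := by
    intro v hv n
    have hex : ∃ s, g^[s] v ∈ K n ∪ ω.comp (K n) :=
      (hreach v hv n).imp fun s hs => Or.inl hs
    have hstay : ∀ k, Nat.find hex ≤ k → g^[k] v ∈ K n ∪ ω.comp (K n) := by
      intro k hk
      induction k, hk using Nat.le_induction with
      | base => exact Nat.find_spec hex
      | succ k _ ih =>
        rw [Function.iterate_succ_apply']
        exact hgD n _ (hitU v hv k) ih
    refine ⟨Nat.find hex, ?_, fun k => ⟨fun h => Nat.find_min' hex h, hstay k⟩⟩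
    -- The first vertex in `K n ∪ C(K n, ω)` lies in `K n`: at time 0 this forces `n = 0`, and later
    -- a vertex of `C(K n, ω)` would have its predecessor in the union as well.
    rcases h0 : Nat.find hex with - | s
    · have h1 := Nat.find_spec hex
      rw [h0] at h1
      rcases Nat.eq_zero_or_pos n with rfl | hn
      · exact hv
      · exact absurd hv (GraphEnd.notMem_of_mem_comp (hK.union_subset_comp hn h1))
    · have h1 := Nat.find_spec hex
      have h2 := Nat.find_min hex (m := s) (by omega)
      rw [h0] at h1
      refine h1.resolve_right fun h3 => h2 ?_
      rw [Function.iterate_succ_apply'] at h3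
      rcases (hgU _ (hitU v hv s)).2.2 with h4 | h4
      · rw [h4] at h3
        exact Or.inr h3
      · by_cases h5 : g^[s] v ∈ K n
        · exact Or.inl h5
        · exact Or.inr (GraphEnd.mem_comp_of_adj h3 h5 h4.symm)
  choose! t ht1 ht2 using hfirst
  have := (hK.1 0).1.to_subtype
  let e : Fin m ≃ K 0 := (Finite.equivFinOfCardEq (hm 0)).symm
  refine ⟨⟨fun i s => g^[s] (e i), fun n i => t (e i) n, ?_, ?_, ?_, ?_⟩⟩
  · intro i j k l h
    obtain ⟨h1, h2⟩ := hitinj _ (e i).2 _ (e j).2 _ _ h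
    exact ⟨e.injective (Subtype.ext h1), h2⟩
  · intro i k
    rw [Function.iterate_succ_apply']
    -- Fixed points of `g` do not occur on these orbits, since the iterates are distinct.
    refine (hgU _ (hitU _ (e i).2 k)).2.2.resolve_left fun h => ?_
    rw [← Function.iterate_succ_apply' (f := g)] at h
    have := (hitinj _ (e i).2 _ (e i).2 _ _ h).2
    omega
  · exact fun n i => ht1 _ (e i).2 n
  · exact fun n i s => ht2 _ (e i).2 n s

/-! ### Building a strip from one segment -/

/-- A finite connected segment `A` between `K = range e` and `τ K`, containing disjoint paths from
`e i` to `τ (e i)`, where `K` separates `C` from its complement and `C` contains the translate of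
`K ∪ C`. -/
structure StripSeed (τ : G ≃g G) (m : ℕ) where
  pos : 0 < m
  e : Fin m → V
  C : Set V
  mem_of_adj : ∀ a b, a ∈ C → G.Adj a b → b ∈ Set.range e ∪ C
  apply_mem : ∀ v ∈ Set.range e ∪ C, τ v ∈ C
  A : Set V
  finite : A.Finite
  subset : A ⊆ Set.range e ∪ C
  apply_notMem : ∀ v ∈ Set.range e ∪ C, τ v ∉ A
  connected : IsConnectedSet G A
  connected_upper : IsConnectedSet G ((A \ Set.range e) ∪ τ '' Set.range e)
  q : Fin m → ℕ → V
  len : Fin m → ℕ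
  len_pos : ∀ i, 0 < len i
  q_zero : ∀ i, q i 0 = e i
  q_len : ∀ i, q i (len i) = τ (e i)
  q_adj : ∀ i k, k < len i → G.Adj (q i k) (q i (k + 1))
  q_mem : ∀ i k, k < len i → q i k ∈ A
  q_inj : ∀ i j k l, k < len i → l < len j → q i k = q j l → i = j ∧ k = l

namespace StripSeed

variable {τ : G ≃g G} {m : ℕ} (D : StripSeed τ m)

theorem zpow_add_apply (τ : G ≃g G) (a b : ℤ) (v : V) : (τ ^ (a + b)) v = (τ ^ a) ((τ ^ b) v) := by
  rw [zpow_add, RelIso.mul_apply]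

theorem zpow_apply_apply (τ : G ≃g G) (n : ℤ) (v : V) : (τ ^ n) (τ v) = (τ ^ (n + 1)) v := by
  rw [zpow_add_one, RelIso.mul_apply]

theorem zpow_adj (τ : G ≃g G) (n : ℤ) {a b : V} (hab : G.Adj a b) :
    G.Adj ((τ ^ n) a) ((τ ^ n) b) :=
  (τ ^ n).map_rel_iff.2 hab

theorem pow_mem (n : ℕ) {v : V} (hv : v ∈ Set.range D.e ∪ D.C) :
    (τ ^ (n : ℤ)) v ∈ Set.range D.e ∪ D.C := by
  induction n with
  | zero => simpa using hv
  | succ n ih =>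
    push_cast
    rw [add_comm, zpow_add_apply, zpow_one]
    exact Or.inr (D.apply_mem _ ih)

theorem zpow_notMem {n : ℤ} (hn : 0 < n) {v : V} (hv : v ∈ Set.range D.e ∪ D.C) :
    (τ ^ n) v ∉ D.A := by
  obtain ⟨k, rfl⟩ : ∃ k : ℕ, n = 1 + k := ⟨(n - 1).toNat, by omega⟩
  rw [zpow_add_apply, zpow_one]
  exact D.apply_notMem _ (D.pow_mem k hv)

/-- The union of the translates of the segment. -/
def verts : Set V := {v | ∃ n : ℤ, (τ ^ (-n)) v ∈ D.A}

/-- The index of the translate of the segment in which a vertex lies. -/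
noncomputable def height (v : D.verts) : ℤ := v.2.choose

theorem height_spec (v : D.verts) : (τ ^ (-D.height v)) (v : V) ∈ D.A := v.2.choose_spec

/-- This makes the translates of `A` disjoint: the height of `v` is the largest `k` for which `v`
lies in the `k`-th translate of `K ∪ C`. -/
theorem le_of_mem {v : V} {n k : ℤ} (hn : (τ ^ (-n)) v ∈ D.A)
    (hk : (τ ^ (-k)) v ∈ Set.range D.e ∪ D.C) : k ≤ n := by
  by_contra! hlt
  have := D.zpow_notMem (n := k - n) (by omega) hk
  rw [← zpow_add_apply, show k - n + -k = -n by ring] at this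
  exact this hn

theorem height_eq {v : D.verts} {n : ℤ} (hn : (τ ^ (-n)) (v : V) ∈ D.A) : D.height v = n :=
  le_antisymm (D.le_of_mem hn (D.subset (D.height_spec v)))
    (D.le_of_mem (D.height_spec v) (D.subset hn))

theorem subset_verts : D.A ⊆ D.verts := fun v hv => ⟨0, by simpa using hv⟩

theorem apply_mem_verts {v : V} (hv : v ∈ D.verts) : τ v ∈ D.verts := by
  obtain ⟨n, hn⟩ := hv
  refine ⟨n + 1, ?_⟩
  rwa [zpow_apply_apply, show -(n + 1) + 1 = -n by ring]

theorem symm_apply_mem_verts {v : V} (hv : v ∈ D.verts) : τ.symm v ∈ D.verts := by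
  obtain ⟨n, hn⟩ := hv
  refine ⟨n - 1, ?_⟩
  have : τ.symm v = (τ ^ (-1 : ℤ)) v := by rw [zpow_neg_one]; rfl
  rwa [this, ← zpow_add_apply, show -(n - 1) + -1 = -n by ring]

/-- The subgraph induced by the union of the translates of the segment. -/
def subgraph : G.Subgraph := (⊤ : G.Subgraph).induce D.verts

theorem subgraph_adj {a b : D.subgraph.verts} :
    D.subgraph.coe.Adj a b ↔ G.Adj (a : V) (b : V) :=
  ⟨fun h => D.subgraph.adj_sub h, fun h => ⟨a.2, b.2, h⟩⟩

/-- The restriction of `τ`. -/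
def restrict : D.subgraph.coe ≃g D.subgraph.coe where
  toFun v := ⟨τ v, D.apply_mem_verts v.2⟩
  invFun v := ⟨τ.symm v, D.symm_apply_mem_verts v.2⟩
  left_inv v := Subtype.ext (τ.symm_apply_apply _)
  right_inv v := Subtype.ext (τ.apply_symm_apply _)
  map_rel_iff' {a b} := by
    rw [subgraph_adj, subgraph_adj]
    exact τ.map_rel_iff

theorem coe_restrict (v : D.subgraph.verts) : (D.restrict v : V) = τ v := rfl

theorem coe_restrict_zpow (n : ℤ) (v : D.subgraph.verts) :
    ((D.restrict ^ n) v : V) = (τ ^ n) (v : V) := by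
  induction n with
  | zero => simp
  | succ n ih =>
    rw [add_comm (n : ℤ) 1, zpow_add_apply, zpow_add_apply, zpow_one, zpow_one, coe_restrict, ih]
  | pred n ih =>
    apply τ.injective
    -- Stated for an arbitrary graph, because it is needed both for `τ` and for its restriction.
    have h1 : ∀ (H : Type u) (S : SimpleGraph H) (ρ : S ≃g S) (w : H),
        ρ ((ρ ^ (-(n : ℤ) - 1)) w) = (ρ ^ (-(n : ℤ))) w := by
      intro H S ρ w
      conv_lhs => rw [← zpow_one ρ]
      rw [zpow_one, ← RelIso.mul_apply, ← zpow_one_add]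
      congr 2
      ring
    rw [← coe_restrict, h1, h1, ih]

theorem range_subset : Set.range D.e ⊆ D.A := by
  rintro _ ⟨i, rfl⟩
  rw [← D.q_zero]
  exact D.q_mem i 0 (D.len_pos i)

/-- The gate vertices as vertices of the strip. -/
def e' (i : Fin m) : D.subgraph.verts := ⟨D.e i, D.subset_verts (D.range_subset ⟨i, rfl⟩)⟩

/-- With `k` the height of `v`, the vertex `v` lies in the translate of `C` of index `k - 1`, so its
neighbour `u` has height at least `k - 1`. As `u` is not in the `k`-th translate of `K ∪ C`, the
vertex `v` is not in that of `C`, hence in that of `K`. -/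
theorem gate_of_adj (u v : D.subgraph.verts) (huv : D.subgraph.coe.Adj u v)
    (hlt : D.height u < D.height v) : D.height v = D.height u + 1 ∧
      ∃ i, v = (D.restrict ^ D.height v) (D.e' i) := by
  rw [subgraph_adj] at huv
  have hu := D.height_spec u
  have hv := D.height_spec v
  constructor
  · by_contra hne
    have h1 : (τ ^ (-(D.height v - 1))) (v : V) ∈ D.C := by
      rw [show -(D.height v - 1) = 1 + -D.height v by ring, zpow_add_apply, zpow_one]
      exact D.apply_mem _ (D.subset hv)
    have h2 := D.mem_of_adj _ _ h1 (zpow_adj τ _ huv.symm)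
    have := D.le_of_mem hu h2
    omega
  · have hu' : (τ ^ (-D.height v)) (u : V) ∉ Set.range D.e ∪ D.C := fun h => by
      have := D.le_of_mem hu h
      omega
    rcases D.subset hv with ⟨i, hi⟩ | h
    · refine ⟨i, Subtype.ext ?_⟩
      rw [coe_restrict_zpow]
      change _ = (τ ^ D.height v) (D.e i)
      rw [hi, ← zpow_add_apply, add_neg_cancel, zpow_zero, RelIso.one_apply]
    · exact absurd (D.mem_of_adj _ _ h (zpow_adj τ _ huv.symm)) hu'

theorem height_zero_iff (v : D.subgraph.verts) : D.height v = 0 ↔ (v : V) ∈ D.A := by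
  constructor
  · intro h
    have := D.height_spec v
    rw [h] at this
    simpa using this
  · intro h
    exact D.height_eq (by simpa using h)

theorem layer_eq : {v : D.subgraph.verts | D.height v = 0} = Subtype.val ⁻¹' D.A := by
  ext v
  exact D.height_zero_iff v

theorem range_e' : Set.range D.e' = Subtype.val ⁻¹' Set.range D.e := by
  ext v
  constructor
  · rintro ⟨i, rfl⟩
    exact ⟨i, rfl⟩
  · rintro ⟨i, hi⟩
    exact ⟨i, Subtype.ext hi⟩

theorem image_range_e' :
    D.restrict '' Set.range D.e' = Subtype.val ⁻¹' (τ '' Set.range D.e) := by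
  ext v
  constructor
  · rintro ⟨_, ⟨i, rfl⟩, rfl⟩
    exact ⟨_, ⟨i, rfl⟩, rfl⟩
  · rintro ⟨_, ⟨i, rfl⟩, hi⟩
    exact ⟨_, ⟨i, rfl⟩, Subtype.ext hi⟩

theorem preimage_connected {U : Set V} (hU : IsConnectedSet G U) (hUW : U ⊆ D.verts) :
    IsConnectedSet D.subgraph.coe (Subtype.val ⁻¹' U) :=
  hU.preimage (fun _ _ h => D.subgraph_adj.2 h) (fun v hv => ⟨⟨v, hUW hv⟩, rfl⟩)
    Subtype.val_injective

theorem q_mem_verts (i : Fin m) (k : ℕ) (hk : k ≤ D.len i) : D.q i k ∈ D.verts := by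
  rcases hk.eq_or_lt with rfl | hk
  · rw [D.q_len]
    exact D.apply_mem_verts (D.e' i).2
  · exact D.subset_verts (D.q_mem i k hk)

open Classical in
/-- The paths as paths of the strip. -/
noncomputable def path (i : Fin m) (k : ℕ) : D.subgraph.verts :=
  if hk : k ≤ D.len i then ⟨D.q i k, D.q_mem_verts i k hk⟩ else D.e' i

theorem coe_path (i : Fin m) (k : ℕ) (hk : k ≤ D.len i) : (D.path i k : V) = D.q i k := by
  rw [path, dif_pos hk]

/-- The strip data on the union of the translates of the segment. -/
noncomputable def stripData : StripData D.subgraph.coe D.restrict m where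
  pos := D.pos
  h := D.height
  e := D.e'
  h_apply v := by
    refine D.height_eq (v := ⟨τ v, D.apply_mem_verts v.2⟩) ?_
    have := D.height_spec v
    change (τ ^ (-(D.height v + 1))) (τ v) ∈ D.A
    rwa [zpow_apply_apply, show -(D.height v + 1) + 1 = -D.height v by ring]
  finite_layer := by
    rw [layer_eq]
    exact D.finite.preimage Subtype.val_injective.injOn
  h_gate i := (D.height_zero_iff _).2 (D.range_subset ⟨i, rfl⟩)
  gate_of_adj := D.gate_of_adj
  connected_layer := by
    rw [layer_eq]
    exact D.preimage_connected D.connected D.subset_verts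
  connected_upper := by
    rw [layer_eq, range_e', ← range_e', image_range_e', range_e', ← Set.preimage_sdiff,
      ← Set.preimage_union]
    refine D.preimage_connected D.connected_upper (Set.union_subset ?_ ?_)
    · exact Set.sdiff_subset.trans D.subset_verts
    · rintro _ ⟨_, ⟨i, rfl⟩, rfl⟩
      exact D.apply_mem_verts (D.e' i).2
  p := D.path
  len := D.len
  len_pos := D.len_pos
  p_zero i := Subtype.ext (by rw [D.coe_path i 0 (Nat.zero_le _), D.q_zero]; rfl)
  p_len i := Subtype.ext (by rw [D.coe_path i _ le_rfl, D.q_len]; rfl)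
  p_adj i k hk := by
    rw [subgraph_adj, D.coe_path i k hk.le, D.coe_path i (k + 1) hk]
    exact D.q_adj i k hk
  h_p i k hk := by
    rw [height_zero_iff, D.coe_path i k hk.le]
    exact D.q_mem i k hk
  p_inj i j k l hk hl h := by
    refine D.q_inj i j k l hk hl ?_
    rw [← D.coe_path i k hk.le, ← D.coe_path j l hl.le, h]

theorem isSubgraphStripOfSize : IsSubgraphStripOfSize D.subgraph τ m :=
  ⟨D.restrict, D.coe_restrict, D.stripData.isStripOfSize⟩

end StripSeed

/-! ### Tight separators and translations -/

/-- The finite connected sets containing two given vertices. -/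
def connectors (G : SimpleGraph V) (a b : V) : Set (Finset V) :=
  {Q | IsConnectedSet G (Q : Set V) ∧ a ∈ Q ∧ b ∈ Q}

theorem image_mem_connectors [DecidableEq V] (γ : G ≃g G) {a b : V} {Q : Finset V}
    (hQ : Q ∈ connectors G a b) : Q.image γ ∈ connectors G (γ a) (γ b) := by
  refine ⟨?_, Finset.mem_image_of_mem _ hQ.2.1, Finset.mem_image_of_mem _ hQ.2.2⟩
  rw [Finset.coe_image]
  exact hQ.1.image fun _ _ h => γ.map_rel_iff.2 h

theorem IsMinimalHittingSet.map [DecidableEq V] (γ : G ≃g G) {a b : V} {L : Finset V}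
    (h : IsMinimalHittingSet (connectors G a b) L) :
    IsMinimalHittingSet (connectors G (γ a) (γ b)) (L.image γ) := by
  constructor
  · intro Q hQ hd
    have hQ' := image_mem_connectors γ.symm hQ
    rw [RelIso.symm_apply_apply, RelIso.symm_apply_apply] at hQ'
    refine h.1 _ hQ' (Finset.disjoint_left.2 fun v hv hvL => ?_)
    obtain ⟨w, hw, rfl⟩ := Finset.mem_image.1 hv
    exact Finset.disjoint_left.1 hd hw (Finset.mem_image.2 ⟨_, hvL, RelIso.apply_symm_apply _ _⟩)
  · intro z hz
    obtain ⟨z, hzL, rfl⟩ := Finset.mem_image.1 hz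
    obtain ⟨Q, hQ, hd⟩ := h.2 z hzL
    refine ⟨_, image_mem_connectors γ hQ, Finset.disjoint_left.2 fun v hv hvL => ?_⟩
    obtain ⟨w, hw, rfl⟩ := Finset.mem_image.1 hv
    obtain ⟨hne, hwL⟩ := Finset.mem_erase.1 hvL
    obtain ⟨w', hw', heq⟩ := Finset.mem_image.1 hwL
    obtain rfl := γ.injective heq
    exact Finset.disjoint_left.1 hd hw (Finset.mem_erase.2 ⟨fun h => hne (by rw [h]), hw'⟩)

/-- The enumerated minimal separators of two neighbours `a`, `b` of their first vertex, together
with `a`. -/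
def tightPairs [DecidableEq V] (G : SimpleGraph V) {m : ℕ} (i₀ : Fin m) : Set ((Fin m → V) × V) :=
  {x | Function.Injective x.1 ∧ G.Adj (x.1 i₀) x.2 ∧ ∃ b, G.Adj (x.1 i₀) b ∧
    IsMinimalHittingSet (connectors G x.2 b) (Finset.univ.image x.1)}

theorem map_mem_tightPairs [DecidableEq V] {m : ℕ} {i₀ : Fin m} (γ : G ≃g G) {e : Fin m → V} {a : V}
    (h : (e, a) ∈ tightPairs G i₀) : (γ ∘ e, γ a) ∈ tightPairs G i₀ := by
  obtain ⟨h1, h2, b, h3, h4⟩ := h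
  refine ⟨γ.injective.comp h1, γ.map_rel_iff.2 h2, γ b, γ.map_rel_iff.2 h3, ?_⟩
  rw [← Finset.image_image]
  exact h4.map γ

/-- Finitely many first vertices have finitely many pairs of neighbours `a`, `b`; each pair has
finitely many minimal separators of size `m`, each with finitely many enumerations. -/
theorem finite_tightPairs [DecidableEq V] (hG : IsLocallyFinite G) {m : ℕ} (i₀ : Fin m) {T : Set V}
    (hT : T.Finite) : {x ∈ tightPairs G i₀ | x.1 i₀ ∈ T}.Finite := by
  refine (hT.biUnion fun x _ => (hG x).biUnion fun a _ => (hG x).biUnion fun b _ =>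
    (finite_minimalHittingSet m (connectors G a b)).biUnion fun L _ =>
      (Set.Finite.pi' fun _ : Fin m => L.finite_toSet).prod (Set.finite_singleton a)).subset ?_
  rintro ⟨e, a⟩ ⟨⟨h1, h2, b, h3, h4⟩, hT⟩
  simp only [Set.mem_iUnion]
  refine ⟨e i₀, hT, a, h2, b, h3, Finset.univ.image e, ⟨?_, h4⟩, ?_, rfl⟩
  · rw [Finset.card_image_of_injective _ h1, Finset.card_univ, Fintype.card_fin]
  · exact fun i => Finset.mem_coe.2 (Finset.mem_image_of_mem _ (Finset.mem_univ i))

theorem ActsQuasiTransitively.exists_finite {Γ : Subgroup (G ≃g G)}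
    (hΓ : ActsQuasiTransitively Γ) :
    ∃ T : Set V, T.Finite ∧ ∀ x, ∃ γ ∈ Γ, γ x ∈ T := by
  let orb : V → Set V := fun x => {y : V | ∃ γ ∈ Γ, γ x = y}
  have hfin : (Set.range orb).Finite := hΓ
  choose rep hrep using fun o : Set.range orb => o.2
  have := hfin.to_subtype
  refine ⟨Set.range rep, Set.finite_range _, fun x => ?_⟩
  have h1 : orb (rep ⟨orb x, Set.mem_range_self x⟩) = orb x := hrep _
  have h2 : rep ⟨orb x, Set.mem_range_self x⟩ ∈ orb x := h1.subset ⟨1, Γ.one_mem, rfl⟩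
  obtain ⟨γ, hγ, h3⟩ := h2
  exact ⟨γ, hγ, _, h3.symm⟩

/-! ### Translations along the rays and the choice of the segment -/

namespace RaySystem

variable {ω : GraphEnd G} {K : ℕ → Set V} {m : ℕ} (R : RaySystem ω K m)

/-- The vertex of the `i`-th ray in `K n`. -/
def e (n : ℕ) (i : Fin m) : V := R.r i (R.t n i)

/-- The successor of `e n i` on the `i`-th ray. -/
def c (n : ℕ) (i : Fin m) : V := R.r i (R.t n i + 1)

theorem e_injective (n : ℕ) : Function.Injective (R.e n) := fun _ _ h => (R.inj _ _ _ _ h).1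

theorem range_e (hK : IsDefiningSequence ω K) (hm : ∀ n, (K n).ncard = m) (n : ℕ) :
    Set.range (R.e n) = K n := by
  refine Set.eq_of_subset_of_ncard_le (by rintro _ ⟨i, rfl⟩; exact R.mem n i) ?_ (hK.1 n).1
  rw [hm, ← Set.image_univ, Set.ncard_image_of_injective _ (R.e_injective n), Set.ncard_univ,
    Nat.card_fin]

theorem mem_comp_of_lt (hK : IsDefiningSequence ω K) (hm : ∀ n, (K n).ncard = m) {n : ℕ}
    {i : Fin m} {k : ℕ} (hk : R.t n i < k) : R.r i k ∈ ω.comp (K n) := by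
  refine ((R.mem_iff n i k).2 hk.le).resolve_left fun h => ?_
  rw [← R.range_e hK hm] at h
  obtain ⟨j, hj⟩ := h
  obtain ⟨rfl, h2⟩ := R.inj _ _ _ _ hj
  omega

/-- Late members of the defining sequence are tight separators. -/
theorem eventually_mem_tightPairs [DecidableEq V] (hG : G.Connected)
    (hK : IsDefiningSequence ω K) (hm : ∀ n, (K n).ncard = m) (i₀ : Fin m) :
    ∃ N, ∀ n, N ≤ n → (R.e n, R.c n i₀) ∈ tightPairs G i₀ := by
  obtain ⟨F, hFfin, -, hF, hFc⟩ :=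
    (isConnectedSet_univ hG).exists_finite_superset (x := fun i => R.r i 0) fun i => trivial
  obtain ⟨N, hN⟩ := hK.eventually_disjoint hG hFfin
  refine ⟨N, fun n hn => ?_⟩
  have hpos : ∀ i, 0 < R.t n i := by
    intro i
    by_contra! h0
    exact hN n hn _ (hF i) ((R.mem_iff n i 0).2 h0)
  have hpre : ∀ i, G.Adj (R.e n i) (R.r i (R.t n i - 1)) := by
    intro i
    have := R.adj i (R.t n i - 1)
    rw [Nat.sub_add_cancel (hpos i)] at this
    exact this.symm
  -- A connected set outside `K n ∪ C(K n, ω)` that contains the parts of all rays before `K n`. It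
  -- plays the other side of the separator.
  let E : Set V := F ∪ ⋃ i, R.r i '' Set.Icc 0 (R.t n i - 1)
  have hE : IsConnectedSet G E := hFc.union_iUnion
    (fun i => isConnectedSet_path (Nat.zero_le _) fun k _ _ => R.adj i k)
    fun i => ⟨_, hF i, _, ⟨0, ⟨le_rfl, Nat.zero_le _⟩, rfl⟩, Or.inl rfl⟩
  have hED : ∀ v ∈ E, v ∉ K n ∪ ω.comp (K n) := by
    rintro v (hv | hv) hvD
    · exact hN n hn v hv hvD
    · obtain ⟨i, k, hk, rfl⟩ := Set.mem_iUnion.1 hv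
      have h1 := (R.mem_iff n i k).1 hvD
      have h2 := hk.2
      have := hpos i
      omega
  have hpreE : ∀ i, R.r i (R.t n i - 1) ∈ E := fun i =>
    Or.inr (Set.mem_iUnion.2 ⟨i, _, ⟨Nat.zero_le _, le_rfl⟩, rfl⟩)
  have hc : ∀ i, R.c n i ∈ ω.comp (K n) := fun i => R.mem_comp_of_lt hK hm (Nat.lt_succ_self _)
  have himg : ∀ v, v ∈ Finset.univ.image (R.e n) ↔ v ∈ K n := by
    intro v
    rw [← R.range_e hK hm n]
    simp
  refine ⟨R.e_injective n, R.adj i₀ _, R.r i₀ (R.t n i₀ - 1), hpre i₀, ?_, ?_⟩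
  · rintro Q ⟨hQ, ha, hb⟩ hd
    have := hQ.subset_comp (K := K n)
      (fun v hv hvK => Finset.disjoint_left.1 hd hv ((himg v).2 hvK)) ha (hc i₀)
    exact hED _ (hpreE i₀) (Or.inr (this hb))
  · intro z hz
    obtain ⟨i, -, rfl⟩ := Finset.mem_image.1 hz
    -- Putting back a single vertex `e n i` reconnects the two sides along the `i`-th ray; hence the
    -- separator is minimal.
    have hU : IsConnectedSet G ((E ∪ {R.e n i}) ∪ ω.comp (K n)) :=
      (hE.union (isConnectedSet_singleton _)
        ⟨_, hpreE i, _, rfl, Or.inr (hpre i).symm⟩).union (ω.isConnectedSet_comp (hK.1 n).1)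
        ⟨_, Or.inr rfl, _, hc i, Or.inr (R.adj i _)⟩
    obtain ⟨Q, hQfin, hQU, hQa, hQb, hQ⟩ :=
      hU.exists_finite (Or.inr (hc i₀)) (Or.inl (Or.inl (hpreE i₀)))
    refine ⟨hQfin.toFinset, ⟨by simpa using hQ, by simpa using hQa, by simpa using hQb⟩,
      Finset.disjoint_left.2 fun v hv hvL => ?_⟩
    obtain ⟨hne, hvK⟩ := Finset.mem_erase.1 hvL
    rw [himg] at hvK
    rcases hQU (hQfin.mem_toFinset.1 hv) with (h | h) | h
    · exact hED v h (Or.inl hvK)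
    · exact hne h
    · exact GraphEnd.notMem_of_mem_comp h hvK

/-- Some member of the defining sequence is mapped by the group to arbitrarily late ones,
respecting the rays and the components. -/
theorem exists_translations (R : RaySystem ω K m) (hG : G.Connected) (hlf : IsLocallyFinite G)
    {Γ : Subgroup (G ≃g G)} (hΓ : ActsQuasiTransitively Γ)
    (hK : IsDefiningSequence ω K) (hm : ∀ n, (K n).ncard = m) (i₀ : Fin m) :
    ∃ n, ∀ M, ∃ l, M < l ∧ ∃ τ ∈ Γ, (∀ i, τ (R.e n i) = R.e l i) ∧
      τ '' ω.comp (K n) = ω.comp (K l) := by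
  classical
  obtain ⟨T, hT, hTΓ⟩ := hΓ.exists_finite
  obtain ⟨N, hN⟩ := R.eventually_mem_tightPairs hG hK hm i₀
  choose γ hγΓ hγT using fun n => hTΓ (R.e n i₀)
  have := (finite_tightPairs hlf i₀ hT).to_subtype
  -- Each late separator with its successor is moved by `Γ` so that its first vertex lies in `T`.
  -- The target is finite, so infinitely many indices share a value.
  let φ : ℕ → {x | x ∈ tightPairs G i₀ ∧ x.1 i₀ ∈ T} := fun n =>
    ⟨(γ (N + n) ∘ R.e (N + n), γ (N + n) (R.c (N + n) i₀)),
      map_mem_tightPairs _ (hN _ (Nat.le_add_right _ _)), hγT _⟩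
  obtain ⟨y, hy⟩ := Finite.exists_infinite_fiber φ
  rw [Set.infinite_coe_iff] at hy
  obtain ⟨n, hn⟩ := hy.nonempty
  refine ⟨N + n, fun M => ?_⟩
  obtain ⟨l, hl, hlM⟩ := hy.exists_gt M
  have heq : φ n = φ l := Eq.trans hn (Eq.symm hl)
  have h1 := congrArg (fun x => x.1.1) heq
  have h2 : γ (N + n) (R.c (N + n) i₀) = γ (N + l) (R.c (N + l) i₀) :=
    congrArg (fun x => x.1.2) heq
  set τ : G ≃g G := (γ (N + l))⁻¹ * γ (N + n) with hτ
  have hτe : ∀ i, τ (R.e (N + n) i) = R.e (N + l) i := by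
    intro i
    have h3 : γ (N + n) (R.e (N + n) i) = γ (N + l) (R.e (N + l) i) := congrFun h1 i
    rw [hτ, RelIso.mul_apply, h3]
    exact RelIso.symm_apply_apply _ _
  have hτc : τ (R.c (N + n) i₀) = R.c (N + l) i₀ := by
    rw [hτ, RelIso.mul_apply, h2]
    exact RelIso.symm_apply_apply _ _
  refine ⟨N + l, by omega, τ, Γ.mul_mem (Γ.inv_mem (hγΓ _)) (hγΓ _), hτe, ?_⟩
  have hτK : ∀ v, τ v ∈ K (N + l) ↔ v ∈ K (N + n) := by
    intro v
    rw [← R.range_e hK hm, ← R.range_e hK hm]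
    constructor
    · rintro ⟨i, hi⟩
      rw [← hτe] at hi
      exact ⟨i, τ.injective hi⟩
    · rintro ⟨i, rfl⟩
      exact ⟨i, (hτe i).symm⟩
  -- The image of `C(K n, ω)` is a component of `G \ K l`. It is the right one because it contains
  -- the successor `c l i₀`; this is why the pairs record the successor.
  symm
  refine comp_eq_of_mem (hK.1 _).1
    ((ω.isConnectedSet_comp (hK.1 _).1).image fun _ _ h => τ.map_rel_iff.2 h) ?_ ?_
    ⟨_, R.mem_comp_of_lt hK hm (Nat.lt_succ_self _), hτc⟩
    (R.mem_comp_of_lt hK hm (Nat.lt_succ_self _))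
  · rintro _ ⟨v, hv, rfl⟩ hvK
    exact GraphEnd.notMem_of_mem_comp hv ((hτK v).1 hvK)
  · rintro _ ⟨v, hv, rfl⟩ b hab hb
    obtain ⟨w, rfl⟩ := τ.surjective b
    exact ⟨w, GraphEnd.mem_comp_of_adj hv (fun h => hb ((hτK w).2 h)) (τ.map_rel_iff.1 hab), rfl⟩

/-- The set `F` joins the successors of the vertices of `K n` inside `C(K n, ω)`, so the segment
remains connected after `K n` is removed and `K l` is added. Taking `l` late keeps `F` out of `K l ∪
C(K l, ω)`, which separates the segment from its later translates. -/
theorem exists_stripSeed (R : RaySystem ω K m) (hG : G.Connected) (hlf : IsLocallyFinite G)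
    {Γ : Subgroup (G ≃g G)} (hΓ : ActsQuasiTransitively Γ)
    (hK : IsDefiningSequence ω K) (hm : ∀ n, (K n).ncard = m) (hpos : 0 < m) :
    ∃ τ ∈ Γ, Nonempty (StripSeed τ m) := by
  obtain ⟨n, hn⟩ := R.exists_translations hG hlf hΓ hK hm ⟨0, hpos⟩
  obtain ⟨F, hFfin, hFC, hcF, hFc⟩ := (ω.isConnectedSet_comp (hK.1 n).1).exists_finite_superset
    (x := R.c n) fun i => R.mem_comp_of_lt hK hm (Nat.lt_succ_self _)
  obtain ⟨N, hN⟩ := hK.eventually_disjoint hG hFfin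
  obtain ⟨l, hl, τ, hτΓ, hτe, hτC⟩ := hn (max n N)
  have hnl : n < l := (le_max_left _ _).trans_lt hl
  have hFl : ∀ v ∈ F, v ∉ K l ∪ ω.comp (K l) := hN l ((le_max_right _ _).trans hl.le)
  have hlt : ∀ i, R.t n i < R.t l i := by
    intro i
    by_contra! hle
    exact GraphEnd.notMem_of_mem_comp
      (hK.union_subset_comp hnl ((R.mem_iff l i _).2 hle)) (R.mem n i)
  have hmemD : ∀ i k, R.r i (R.t n i + k) ∈ K n ∪ ω.comp (K n) := fun i k =>
    (R.mem_iff n i _).2 (Nat.le_add_right _ _)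
  have hτD : ∀ v ∈ K n ∪ ω.comp (K n), τ v ∈ K l ∪ ω.comp (K l) := by
    rintro v (hv | hv)
    · rw [← R.range_e hK hm] at hv
      obtain ⟨i, rfl⟩ := hv
      rw [hτe]
      exact Or.inl (R.mem l i)
    · rw [← hτC]
      exact Or.inr ⟨v, hv, rfl⟩
  let q : Fin m → ℕ → V := fun i k => R.r i (R.t n i + k)
  let len : Fin m → ℕ := fun i => R.t l i - R.t n i
  have hlen : ∀ i, R.t n i + len i = R.t l i := fun i => by
    have := hlt i
    simp only [len]
    omega
  have hlen_pos : ∀ i, 0 < len i := fun i => by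
    have := hlt i
    have := hlen i
    omega
  have hq_adj : ∀ i k, G.Adj (q i k) (q i (k + 1)) := fun i k => R.adj i _
  have hq_inj : ∀ i j k l, q i k = q j l → i = j ∧ k = l := by
    intro i j k l h
    obtain ⟨rfl, h⟩ := R.inj _ _ _ _ h
    exact ⟨rfl, by omega⟩
  have hq_len : ∀ i, q i (len i) = τ (R.e n i) := fun i => by
    rw [hτe]
    exact congrArg (R.r i) (hlen i)
  have hq_notMem : ∀ i k, k < len i → q i k ∉ K l ∪ ω.comp (K l) := by
    intro i k hk h
    have := (R.mem_iff l i _).1 h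
    have := hlen i
    omega
  -- The paths stop at `len i - 1`: their last vertices lie in `K l` and belong to the next
  -- translate.
  let A : Set V := F ∪ ⋃ i, q i '' Set.Icc 0 (len i - 1)
  have hqA : ∀ i k, k < len i → q i k ∈ A := fun i k hk =>
    Or.inr (Set.mem_iUnion.2 ⟨i, k, ⟨Nat.zero_le _, by omega⟩, rfl⟩)
  have hA : ∀ v ∈ A, v ∈ F ∨ ∃ i k, k < len i ∧ v = q i k := by
    rintro v (hv | hv)
    · exact Or.inl hv
    · obtain ⟨i, k, hk, rfl⟩ := Set.mem_iUnion.1 hv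
      have h1 := hk.2
      have := hlen_pos i
      exact Or.inr ⟨i, k, by omega, rfl⟩
  -- Exchanging `K n` for its translate shifts the index range of every path by one, so
  -- connectedness follows as for `A`.
  have hupper : (A \ Set.range (R.e n)) ∪ τ '' Set.range (R.e n) =
      F ∪ ⋃ i, q i '' Set.Icc 1 (len i) := by
    ext v
    constructor
    · rintro (⟨hv, hve⟩ | ⟨_, ⟨i, rfl⟩, rfl⟩)
      · rcases hA v hv with hv | ⟨i, k, hk, rfl⟩
        · exact Or.inl hv
        · refine Or.inr (Set.mem_iUnion.2 ⟨i, k, ⟨?_, hk.le⟩, rfl⟩)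
          by_contra hk0
          obtain rfl : k = 0 := by omega
          exact hve ⟨i, rfl⟩
      · exact Or.inr (Set.mem_iUnion.2 ⟨i, len i, ⟨hlen_pos i, le_rfl⟩, hq_len i⟩)
    · rintro (hv | hv)
      · refine Or.inl ⟨Or.inl hv, fun hve => ?_⟩
        rw [R.range_e hK hm] at hve
        exact GraphEnd.notMem_of_mem_comp (hFC hv) hve
      · obtain ⟨i, k, hk, rfl⟩ := Set.mem_iUnion.1 hv
        rcases hk.2.eq_or_lt with hk' | hk'
        · right
          rw [hk', hq_len]
          exact ⟨_, ⟨i, rfl⟩, rfl⟩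
        · refine Or.inl ⟨hqA i k hk', ?_⟩
          rintro ⟨j, hj⟩
          have := (hq_inj j i 0 k hj).2
          have := hk.1
          omega
  refine ⟨τ, hτΓ, ⟨⟨hpos, R.e n, ω.comp (K n), ?_, ?_, A, ?_, ?_, ?_, ?_, ?_, q, len, hlen_pos,
    fun i => rfl, hq_len, fun i k _ => hq_adj i k, hqA, fun i j k l _ _ => hq_inj i j k l⟩⟩⟩
  · intro a b ha hab
    rw [R.range_e hK hm]
    by_cases hb : b ∈ K n
    · exact Or.inl hb
    · exact Or.inr (GraphEnd.mem_comp_of_adj ha hb hab)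
  · intro v hv
    rw [R.range_e hK hm] at hv
    exact hK.union_subset_comp hnl (hτD v hv)
  · exact hFfin.union (Set.finite_iUnion fun i => (Set.finite_Icc _ _).image _)
  · intro v hv
    rw [R.range_e hK hm]
    rcases hA v hv with hv | ⟨i, k, -, rfl⟩
    · exact Or.inr (hFC hv)
    · exact hmemD i k
  · intro v hv hvA
    rw [R.range_e hK hm] at hv
    have h1 := hτD v hv
    rcases hA _ hvA with h | ⟨i, k, hk, h⟩
    · exact hFl _ h h1
    · rw [h] at h1
      exact hq_notMem i k hk h1
  · exact hFc.union_iUnion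
      (fun i => isConnectedSet_path (Nat.zero_le _) fun k _ _ => hq_adj i k)
      fun i => ⟨_, hcF i, _, ⟨0, ⟨le_rfl, Nat.zero_le _⟩, rfl⟩, Or.inr (R.adj i _).symm⟩
  · rw [hupper]
    exact hFc.union_iUnion
      (fun i => isConnectedSet_path (hlen_pos i) fun k _ _ => hq_adj i k)
      fun i => ⟨_, hcF i, _, ⟨1, ⟨le_rfl, hlen_pos i⟩, rfl⟩, Or.inl rfl⟩

end RaySystem

end GraphStrip

/-! ### Strips along a thin end of a quasi-transitive graph -/

theorem lemma3p3 {V : Type*} (X : SimpleGraph V)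
    (hconn : X.Connected) (hfin : GraphStrip.IsLocallyFinite X)
    (Γ : Subgroup (X ≃g X)) (hΓ : GraphStrip.ActsQuasiTransitively Γ)
    (m : ℕ) (ω : GraphStrip.GraphEnd X) (hω : ω.IsThinOfSize m) :
    ∃ τ ∈ Γ, ∃ S : X.Subgraph, GraphStrip.IsSubgraphStripOfSize S τ m := by
  obtain ⟨K, hK, hm⟩ := hω.1
  obtain ⟨N, hN⟩ := GraphStrip.eventually_not_separated hconn hω hK
  -- After the first `N` members are dropped, non-separation holds from index 0 on, where the rays
  -- start.
  have hK' : GraphStrip.IsDefiningSequence ω fun n => K (N + n) :=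
    hK.comp (φ := fun n => N + n) fun _ _ h => Nat.add_lt_add_left h N
  obtain ⟨R⟩ := hK'.nonempty_raySystem (fun n => hm _) fun n => hN _ (Nat.le_add_right N n)
  have hpos : 0 < m := by
    rw [← hm 0, Set.ncard_pos (hK.1 0).1]
    exact (hK.1 0).2
  obtain ⟨τ, hτ, ⟨D⟩⟩ := R.exists_stripSeed hconn hfin hΓ hK' (fun n => hm _) hpos
  exact ⟨τ, hτ, D.subgraph, D.isSubgraphStripOfSize⟩
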